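/- Noisy group testing. Among $p$ items, an unknown defective set $S\subseteq\{1,\dots,p\}$ is uniformly distributed over the $\binom{p}{k}$ subsets of size $k$. The $n$ tests are given by a matrix $\mathbf X\in\{0,1\}^{n\times p}$ with i.i.d. $\mathrm{Bernoulli}\big(\frac{\nu}{k}\big)$ entries, $\nu=\log 2$, and the $i$-th outcome is $$Y^{(i)}=\mathbf 1\Big\{\bigcup_{j\in S}\{X^{(i)}_j=1\}\Big\}\oplus Z^{(i)},$$ where $Z^{(1)},\dots,Z^{(n)}$ are i.i.d. $\mathrm{Bernoulli}(\rho)$, $\oplus$ is addition modulo $2$, and $S,\mathbf X,Z$ are independent. A decoder is a deterministic map producing an estimate $\hat S$ of $S$ from $(\mathbf X,\mathbf Y)$ (it may depend on $p,k,n,\rho$), and $P_e:=\mathbb P[\hat S\neq S]$. Logarithms are natural, and $H_2(\rho):=-\rho\log\rho-(1-\rho)\log(1-\rho)$. Fix $\rho\in(0,\frac12)$, not depending on $p$. For $\theta\in(0,1)$ and $\delta_2\in(0,1)$ put $$\zeta(\rho,\delta_2,\theta):=\frac{2}{\log 2}\max\left\{\frac{2\big(1+\frac13\delta_2(1-2\rho)\big)\frac{\theta}{1-\theta}}{\delta_2^2(1-2\rho)^2},\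 \frac{\frac{1+4\theta}{1-\theta}}{(1-2\rho)\log\frac{1-\rho}{\rho}\,(1-\delta_2)}\right\}.$$ (i) Let $\theta\in(0,1)$ and let $k=k(p)$ satisfy $k=\Theta(p^\theta)$. If for some $\eta>0$ (not depending on $p$) the number of tests $n=n(p)$ satisfies, for all sufficiently large $p$, $$n\ \ge\ \inf_{\delta_2\in(0,1)}\max\left\{\zeta(\rho,\delta_2,\theta),\ \frac{1}{\log 2-H_2(\rho)}\right\}\Big(k\log\frac pk\Big)(1+\eta),$$ then there is a sequence of decoders with $P_e\to0$ as $p\to\infty$. (ii) Let $\theta$ and $k$ be as in (i). If for some $\eta>0$ and all sufficiently large $p$ $$n\ \le\ \frac{k\log\frac pk}{\log 2-H_2(\rho)}(1-\eta),$$ then $P_e\to1$ as $p\to\infty$ for every sequence of decoders. (iii) There is $\theta_0=\theta_0(\rho)\in(0,1)$ such that for every $\theta\in(0,\theta_0)$ the infimum in (i) equals $\frac{1}{\log 2-H_2(\rho)}$; consequently, for all $k=\Theta(p^\theta)$ with such $\theta$, $n^*=\frac{k\log\frac pk}{\log 2-H_2(\rho)}$ is an exact threshold: for every $\eta>0$,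 a suitable sequence of decoders has $P_e\to0$ when $n\ge n^*(1+\eta)$ for all large $p$, and every sequence of decoders has $P_e\to1$ when $n\le n^*(1-\eta)$ for all large $p$. -/

import Mathlib

open Filter Topology Asymptotics

noncomputable section

namespace NoisyGT

/-- Probability mass function of a Bernoulli(`q`) bit: `1` (`true`) has mass `q`. -/
def bernoulliMass (q : ℝ) (b : Bool) : ℝ := if b = true then q else 1 - q

/-- Probability of an `n × p` binary measurement matrix whose entries are i.i.d. Bernoulli(`q`). -/
def matrixMass {n p : ℕ} (q : ℝ) (X : Fin n → Fin p → Bool) : ℝ :=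
  ∏ i, ∏ j, bernoulliMass q (X i j)

/-- Probability of a noise vector of `n` bits which are i.i.d. Bernoulli(`ρ`). -/
def noiseMass {n : ℕ} (ρ : ℝ) (Z : Fin n → Bool) : ℝ :=
  ∏ i, bernoulliMass ρ (Z i)

/-- The noisy outcomes: the `i`-th one says whether some item of the defective set `S` takes part
in the `i`-th test, plus the `i`-th noise bit modulo two. -/
def outcome {n p : ℕ} (S : Finset (Fin p)) (X : Fin n → Fin p → Bool) (Z : Fin n → Bool) :
    Fin n → Bool :=
  fun i => xor (decide (∃ j ∈ S, X i j = true)) (Z i)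

/-- A (deterministic) decoder: it estimates the defective set from the measurement matrix and the
outcomes. -/
abbrev Decoder (n p : ℕ) : Type :=
  (Fin n → Fin p → Bool) → (Fin n → Bool) → Finset (Fin p)

/-- The error probability `ℙ[Ŝ ≠ S]` of the decoder `dec`, where `S` is uniform on the subsets of
the `p` items having cardinality `k`, the measurement matrix is i.i.d. Bernoulli(`ν / k`), the noise
is i.i.d. Bernoulli(`ρ`), and the three are independent. -/
def errorProb {n p : ℕ} (ρ ν : ℝ) (k : ℕ) (dec : Decoder n p) : ℝ :=
  ∑ S ∈ Finset.powersetCard k (Finset.univ : Finset (Fin p)),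
    ∑ X : Fin n → Fin p → Bool, ∑ Z : Fin n → Bool,
      ((p.choose k : ℝ)⁻¹ * matrixMass (ν / k) X * noiseMass ρ Z) *
        (if dec X (outcome S X Z) ≠ S then 1 else 0)

/-- With `k p` defectives and `n p` tests among `p` items, `P_e → 0` as `p → ∞` is attained by a
suitable decoder. -/
def ErrorVanishes (ρ ν : ℝ) (k n : ℕ → ℕ) : Prop :=
  ∃ dec : (p : ℕ) → Decoder (n p) p,
    Tendsto (fun p : ℕ => errorProb ρ ν (k p) (dec p)) atTop (𝓝 0)

/-- With `k p` defectives and `n p` tests among `p` items, `P_e → 1` as `p → ∞` for every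
decoder. -/
def ErrorTendsToOne (ρ ν : ℝ) (k n : ℕ → ℕ) : Prop :=
  ∀ dec : (p : ℕ) → Decoder (n p) p,
    Tendsto (fun p : ℕ => errorProb ρ ν (k p) (dec p)) atTop (𝓝 1)

/-- `nstar` is an exact threshold on the number of tests (the strong converse holds with it):
for all `η > 0`, a number of tests `n ≥ nstar (1 + η)` gives `P_e → 0`, and
`n ≤ nstar (1 - η)` gives `P_e → 1`. -/
def IsExactThreshold (ρ ν : ℝ) (k : ℕ → ℕ) (nstar : ℕ → ℝ) : Prop :=
  ∀ η : ℝ, 0 < η → ∀ n : ℕ → ℕ,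
    ((∀ᶠ p : ℕ in atTop, nstar p * (1 + η) ≤ (n p : ℝ)) → ErrorVanishes ρ ν k n) ∧
    ((∀ᶠ p : ℕ in atTop, (n p : ℝ) ≤ nstar p * (1 - η)) → ErrorTendsToOne ρ ν k n)

/-- The quantity `ζ(ρ, δ₂, θ)`. -/
def zeta (ρ δ θ : ℝ) : ℝ :=
  2 / Real.log 2 *
    max (2 * (1 + 1 / 3 * δ * (1 - 2 * ρ)) * (θ / (1 - θ)) / (δ ^ 2 * (1 - 2 * ρ) ^ 2))
      ((1 + 4 * θ) / (1 - θ) / ((1 - 2 * ρ) * Real.log ((1 - ρ) / ρ) * (1 - δ)))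

/-- The constant `inf_{δ₂ ∈ (0,1)} max {ζ(ρ, δ₂, θ), 1 / (log 2 - H₂(ρ))}`. -/
def achConst (ρ θ : ℝ) : ℝ :=
  ⨅ δ : Set.Ioo (0 : ℝ) 1, max (zeta ρ δ θ) (1 / (Real.log 2 - Real.binEntropy ρ))

end NoisyGT

end

/-! Achievability. A `k`-set `S` is accepted when, for every nonempty `T ⊆ S`, the likelihood ratio
of the outcomes given the participation of `S \ T` and `T`, against that of `S \ T` alone, exceeds
`exp γ` with `γ` depending on `T.card`. For a wrong `S'` and `T = S' \ S`, the columns of `T` are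
independent of the outcomes and `T` has the size of `S \ S'`, so the ratio has mean one. Markov's
inequality and a union bound then dictate `γ`: the logarithm of the number of such `S'`, plus `2 log
k` (`sum_likelihood_wrong_le`, `threshold`). The true set fails a test with a probability bounded by
Chernoff's method and Bernstein's moment estimate (`sum_likelihood_le`, `ratioMoment_le`).

What matters is the mean and the second moment of the per-test log-ratio when `T` has `l` elements.
With `q = 1 - ν / k` and `I` for `mutualInfo ρ`, the mean is `q ^ k * ψ(-l log q)`, where `ψ(t) =
exp t * I(exp (-t))` is concave and `ψ(0) = 0`. Concavity bounds the mean below by about `C l / k`,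
`C = log 2 - H₂(ρ)`, which suffices when `l / k` is bounded below, concentration being easy there.
For small `l / k`, the slope `D = (1 - 2ρ) log ((1 - ρ) / ρ)` of `ψ` at zero and a first-order bound
on the second moment produce the two terms of `zeta`.

Converse. Apart from an event of exponentially small probability, a noise vector has mass at most
`exp γ * 2⁻ⁿ`. For a given matrix there are `2ⁿ` outcome vectors, each decoded to one set, so the
remaining success probability is at most `exp γ / p.choose k` (`one_sub_errorProb_le`).

Matching. As `θ → 0` the first term of `zeta` disappears and `zeta` tends to `2 / (log 2 * D * (1 -
δ))`. The strict decrease of `ψ'` gives `C < (log 2 / 2) * D`, so for a suitable `δ` the constant `1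
/ C` dominates (`log_two_sub_binEntropy_lt`, `exists_achConst_eq`). -/

namespace NoisyGT

/-! ### Product laws of matrix and noise; independence of hits -/

/-- Whether some item of `A` takes part in the test with participation vector `x`. -/
def hit {p : ℕ} (A : Finset (Fin p)) (x : Fin p → Bool) : Bool := decide (∃ j ∈ A, x j = true)

/-- Probability of a row of an i.i.d. Bernoulli(`a`) matrix. -/
noncomputable def rowMass {p : ℕ} (a : ℝ) (x : Fin p → Bool) : ℝ := ∏ j, bernoulliMass a (x j)

/-- Law of `hit A` for a set `A` of `m` items. -/
noncomputable def hitMass (a : ℝ) (m : ℕ) (b : Bool) : ℝ := bernoulliMass (1 - (1 - a) ^ m) b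

lemma bernoulliMass_nonneg {q : ℝ} (h0 : 0 ≤ q) (h1 : q ≤ 1) (b : Bool) :
    0 ≤ bernoulliMass q b := by
  cases b <;> simp [bernoulliMass] <;> linarith

lemma bernoulliMass_pos {q : ℝ} (h0 : 0 < q) (h1 : q < 1) (b : Bool) :
    0 < bernoulliMass q b := by
  cases b <;> simp [bernoulliMass] <;> linarith

lemma sum_bernoulliMass (q : ℝ) : ∑ b, bernoulliMass q b = 1 := by
  simp [bernoulliMass]

lemma matrixMass_eq {n p : ℕ} (a : ℝ) (X : Fin n → Fin p → Bool) :
    matrixMass a X = ∏ i, rowMass a (X i) := rfl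

lemma matrixMass_nonneg {n p : ℕ} {a : ℝ} (h0 : 0 ≤ a) (h1 : a ≤ 1) (X : Fin n → Fin p → Bool) :
    0 ≤ matrixMass a X :=
  Finset.prod_nonneg fun _ _ => Finset.prod_nonneg fun _ _ => bernoulliMass_nonneg h0 h1 _

lemma noiseMass_nonneg {n : ℕ} {ρ : ℝ} (h0 : 0 ≤ ρ) (h1 : ρ ≤ 1) (Z : Fin n → Bool) :
    0 ≤ noiseMass ρ Z :=
  Finset.prod_nonneg fun _ _ => bernoulliMass_nonneg h0 h1 _

lemma sum_rowMass {p : ℕ} (a : ℝ) : ∑ x : Fin p → Bool, rowMass a x = 1 := by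
  have h := Fintype.prod_sum (fun (_ : Fin p) (b : Bool) => bernoulliMass a b)
  simp only [sum_bernoulliMass, Finset.prod_const_one] at h
  exact h.symm

lemma sum_noiseMass_mul {n : ℕ} (ρ : ℝ) (F : Fin n → Bool → ℝ) :
    ∑ Z : Fin n → Bool, noiseMass ρ Z * ∏ i, F i (Z i)
      = ∏ i, ∑ b, bernoulliMass ρ b * F i b := by
  rw [Fintype.prod_sum]
  simp only [noiseMass, Finset.prod_mul_distrib]

lemma sum_noiseMass {n : ℕ} (ρ : ℝ) : ∑ Z : Fin n → Bool, noiseMass ρ Z = 1 := by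
  have h := sum_noiseMass_mul (n := n) ρ (fun _ _ => 1)
  simpa only [sum_bernoulliMass, mul_one, Finset.prod_const_one] using h

lemma sum_matrixMass_mul {n p : ℕ} (a : ℝ) (G : (Fin p → Bool) → ℝ) :
    ∑ X : Fin n → Fin p → Bool, matrixMass a X * ∏ i, G (X i)
      = (∑ x, rowMass a x * G x) ^ n := by
  have h := Fintype.prod_sum (fun (_ : Fin n) (x : Fin p → Bool) => rowMass a x * G x)
  simp only [Finset.prod_const, Finset.card_univ, Fintype.card_fin] at h
  rw [h]
  simp only [matrixMass_eq, Finset.prod_mul_distrib]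

lemma sum_matrixMass {n p : ℕ} (a : ℝ) : ∑ X : Fin n → Fin p → Bool, matrixMass a X = 1 := by
  have h := sum_matrixMass_mul (n := n) (p := p) a (fun _ => 1)
  simpa [sum_rowMass] using h

/-- Expectation of a product over independent tests. -/
lemma sum_matrixMass_noiseMass_mul {n p : ℕ} (a ρ : ℝ) (F : (Fin p → Bool) → Bool → ℝ) :
    ∑ X : Fin n → Fin p → Bool, ∑ Z : Fin n → Bool,
        matrixMass a X * noiseMass ρ Z * ∏ i, F (X i) (Z i)
      = (∑ x, rowMass a x * ∑ b, bernoulliMass ρ b * F x b) ^ n := by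
  rw [← sum_matrixMass_mul]
  refine Finset.sum_congr rfl fun X _ => ?_
  rw [← sum_noiseMass_mul, Finset.mul_sum]
  exact Finset.sum_congr rfl fun Z _ => by ring

/-- Indicator that no item of `A` takes part. -/
lemma miss_eq_prod {p : ℕ} (A : Finset (Fin p)) (x : Fin p → Bool) :
    (if hit A x = true then (0 : ℝ) else 1) = ∏ j, if j ∈ A ∧ x j = true then 0 else 1 := by
  by_cases h : ∃ j ∈ A, x j = true
  · obtain ⟨j, hj, hx⟩ := h
    have h1 : hit A x = true := by simpa [hit] using ⟨j, hj, hx⟩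
    rw [if_pos h1, Finset.prod_eq_zero (Finset.mem_univ j)]
    simp [hj, hx]
  · have h1 : ¬ hit A x = true := by simpa [hit] using h
    rw [if_neg h1, Finset.prod_eq_one]
    intro j _
    rw [if_neg fun hj => h ⟨j, hj⟩]

lemma sum_rowMass_miss {p : ℕ} (a : ℝ) (A : Finset (Fin p)) :
    ∑ x, rowMass a x * (if hit A x = true then (0 : ℝ) else 1) = (1 - a) ^ A.card := by
  simp only [miss_eq_prod, rowMass, ← Finset.prod_mul_distrib]
  have h := Fintype.prod_sum
    (fun (j : Fin p) (b : Bool) => bernoulliMass a b * if j ∈ A ∧ b = true then 0 else 1)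
  rw [← h]
  have h2 : ∀ j : Fin p, ∑ b, bernoulliMass a b * (if j ∈ A ∧ b = true then (0 : ℝ) else 1)
      = if j ∈ A then 1 - a else 1 := by
    intro j
    by_cases hj : j ∈ A <;> simp [hj, bernoulliMass]
  rw [Finset.prod_congr rfl fun j _ => h2 j]
  simp

lemma miss_union {p : ℕ} (A B : Finset (Fin p)) (x : Fin p → Bool) :
    (if hit A x = true then (0 : ℝ) else 1) * (if hit B x = true then 0 else 1)
      = if hit (A ∪ B) x = true then 0 else 1 := by
  have : hit (A ∪ B) x = (hit A x || hit B x) := by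
    rw [Bool.eq_iff_iff]
    simp only [hit, Finset.mem_union, Bool.or_eq_true, decide_eq_true_eq]
    constructor
    · rintro ⟨j, h | h, hx⟩
      · exact Or.inl ⟨j, h, hx⟩
      · exact Or.inr ⟨j, h, hx⟩
    · rintro (⟨j, h, hx⟩ | ⟨j, h, hx⟩)
      · exact ⟨j, Or.inl h, hx⟩
      · exact ⟨j, Or.inr h, hx⟩
  rw [this]
  cases hit A x <;> cases hit B x <;> simp

/-- For disjoint sets of items the hits are independent. -/
lemma sum_rowMass_hit {p : ℕ} (a : ℝ) {A B D : Finset (Fin p)} (hAB : Disjoint A B)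
    (hAD : Disjoint A D) (hBD : Disjoint B D) (F : Bool → Bool → Bool → ℝ) :
    ∑ x, rowMass a x * F (hit A x) (hit B x) (hit D x)
      = ∑ b, hitMass a A.card b * ∑ c, hitMass a B.card c * ∑ d, hitMass a D.card d * F b c d := by
  set e : Finset (Fin p) → (Fin p → Bool) → ℝ := fun A x => if hit A x = true then 0 else 1 with he
  have hE : ∀ A : Finset (Fin p), ∑ x, rowMass a x * e A x = (1 - a) ^ A.card := sum_rowMass_miss a
  have hU : ∀ (A B : Finset (Fin p)) x, e A x * e B x = e (A ∪ B) x := miss_union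
  -- A function of three bits is a combination of products of the miss indicators. Such a product is
  -- the miss indicator of a union, whose mean is a power of `1 - a`; disjointness makes the
  -- exponents add.
  have hF : ∀ x, rowMass a x * F (hit A x) (hit B x) (hit D x)
      = F true true true * rowMass a x
        + (F false true true - F true true true) * (rowMass a x * e A x)
        + (F true false true - F true true true) * (rowMass a x * e B x)
        + (F true true false - F true true true) * (rowMass a x * e D x)
        + (F false false true - F false true true - F true false true + F true true true)
            * (rowMass a x * e (A ∪ B) x)
        + (F false true false - F false true true - F true true false + F true true true)
            * (rowMass a x * e (A ∪ D) x)
        + (F true false false - F true false true - F true true false + F true true true)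
            * (rowMass a x * e (B ∪ D) x)
        + (F false false false - F false false true - F false true false - F true false false
            + F false true true + F true false true + F true true false - F true true true)
            * (rowMass a x * e (A ∪ B ∪ D) x) := by
    intro x
    simp only [← hU]
    simp only [he]
    cases hit A x <;> cases hit B x <;> cases hit D x <;> simp <;> ring
  rw [Finset.sum_congr rfl fun x _ => hF x]
  simp only [Finset.sum_add_distrib, ← Finset.mul_sum, hE, sum_rowMass]
  rw [Finset.card_union_of_disjoint hAB, Finset.card_union_of_disjoint hAD,
    Finset.card_union_of_disjoint hBD,
    Finset.card_union_of_disjoint (Finset.disjoint_union_left.2 ⟨hAD, hBD⟩),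
    Finset.card_union_of_disjoint hAB]
  simp [hitMass, bernoulliMass]
  ring

/-! ### Error probability conditioned on the defective set -/

/-- The error probability given that the defective set is `S`. -/
noncomputable def condError {n p : ℕ} (ρ a : ℝ) (dec : Decoder n p) (S : Finset (Fin p)) : ℝ :=
  ∑ X : Fin n → Fin p → Bool, ∑ Z : Fin n → Bool,
    matrixMass a X * noiseMass ρ Z * (if dec X (outcome S X Z) ≠ S then 1 else 0)

lemma errorProb_eq {n p : ℕ} (ρ ν : ℝ) (k : ℕ) (dec : Decoder n p) :
    errorProb ρ ν k dec = (p.choose k : ℝ)⁻¹ *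
      ∑ S ∈ Finset.powersetCard k (Finset.univ : Finset (Fin p)), condError ρ (ν / k) dec S := by
  simp only [errorProb, condError, Finset.mul_sum]
  refine Finset.sum_congr rfl fun S _ => Finset.sum_congr rfl fun X _ =>
    Finset.sum_congr rfl fun Z _ => by ring

lemma errorProb_nonneg {n p : ℕ} {ρ ν : ℝ} {k : ℕ} (h0 : 0 ≤ ρ) (h1 : ρ ≤ 1)
    (ha0 : 0 ≤ ν / k) (ha1 : ν / k ≤ 1) (dec : Decoder n p) : 0 ≤ errorProb ρ ν k dec := by
  rw [errorProb_eq]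
  refine mul_nonneg (by positivity) (Finset.sum_nonneg fun S _ => Finset.sum_nonneg fun X _ =>
    Finset.sum_nonneg fun Z _ => mul_nonneg (mul_nonneg (matrixMass_nonneg ha0 ha1 X)
      (noiseMass_nonneg h0 h1 Z)) (by split_ifs <;> norm_num))

lemma errorProb_le {n p : ℕ} {ρ ν : ℝ} {k : ℕ} {dec : Decoder n p} {B : ℝ} (hB : 0 ≤ B)
    (h : ∀ S : Finset (Fin p), S.card = k → condError ρ (ν / k) dec S ≤ B) :
    errorProb ρ ν k dec ≤ B := by
  rw [errorProb_eq]
  have h1 : ∑ S ∈ Finset.powersetCard k (Finset.univ : Finset (Fin p)), condError ρ (ν / k) dec S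
      ≤ (p.choose k : ℝ) * B := by
    refine (Finset.sum_le_card_nsmul _ _ B fun S hS => h S (Finset.mem_powersetCard.1 hS).2).trans ?_
    simp
  -- If `k > p` there is no defective set and the inverse of zero is zero, so the left side is zero.
  rcases Nat.eq_zero_or_pos (p.choose k) with h0 | h0
  · simp [h0, hB]
  · have : (0 : ℝ) < p.choose k := by exact_mod_cast h0
    calc _ ≤ (p.choose k : ℝ)⁻¹ * ((p.choose k : ℝ) * B) := by gcongr
      _ = B := by field_simp

/-! ### Bernstein's exponential moment bound -/

lemma two_mul_three_pow_le_factorial (n : ℕ) : 2 * 3 ^ n ≤ (n + 2).factorial := by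
  induction n with
  | zero => norm_num
  | succ n ih =>
    rw [show n + 1 + 2 = (n + 2) + 1 by ring, Nat.factorial_succ, pow_succ]
    nlinarith [Nat.zero_le n]

/-- The quadratic bound on the exponential behind Bernstein's inequality. -/
lemma exp_le_one_add_add_sq {z t : ℝ} (hz : |z| ≤ t) (ht : t < 3) :
    Real.exp z ≤ 1 + z + z ^ 2 / (2 * (1 - t / 3)) := by
  have h0 : 0 ≤ t := (abs_nonneg z).trans hz
  have h1 : HasSum (fun n : ℕ => z ^ n / n.factorial) (Real.exp z) := by
    rw [Real.exp_eq_exp_ℝ]; exact NormedSpace.expSeries_div_hasSum_exp z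
  have h2 := (hasSum_nat_add_iff' 2).2 h1
  -- The Taylor tail of order two is dominated by a geometric series of ratio `t / 3`, because `(n +
  -- 2)! ≥ 2 * 3 ^ n`; hence the condition `t < 3`.
  have h3 : HasSum (fun n : ℕ => z ^ 2 / 2 * (t / 3) ^ n) (z ^ 2 / 2 * (1 - t / 3)⁻¹) :=
    (hasSum_geometric_of_lt_one (by positivity) (by linarith)).mul_left _
  have h4 := hasSum_le (fun n => ?_) h2 h3
  · simp [Finset.sum_range_succ] at h4
    have : z ^ 2 / (2 * (1 - t / 3)) = z ^ 2 / 2 * (1 - t / 3)⁻¹ := by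
      have : (1 - t / 3) ≠ 0 := by linarith
      field_simp
    linarith
  · have hf : (2 * 3 ^ n : ℝ) ≤ ((n + 2).factorial : ℝ) := by
      exact_mod_cast two_mul_three_pow_le_factorial n
    have hzn : z ^ (n + 2) ≤ z ^ 2 * t ^ n := by
      calc z ^ (n + 2) ≤ |z ^ (n + 2)| := le_abs_self _
        _ = z ^ 2 * |z| ^ n := by rw [pow_add, abs_mul, abs_pow, abs_pow, sq_abs]; ring
        _ ≤ z ^ 2 * t ^ n := by gcongr
    calc z ^ (n + 2) / ((n + 2).factorial : ℝ) ≤ z ^ 2 * t ^ n / ((n + 2).factorial : ℝ) := by gcongr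
      _ ≤ z ^ 2 * t ^ n / (2 * 3 ^ n) := by gcongr
      _ = z ^ 2 / 2 * (t / 3) ^ n := by rw [div_pow]; ring

/-- Bernstein's bound on a moment generating function. -/
lemma sum_mul_exp_le {ι : Type*} [Fintype ι] {m f : ι → ℝ} (hm : ∀ i, 0 ≤ m i)
    (hm1 : ∑ i, m i = 1) {s t : ℝ} (hf : ∀ i, |s * f i| ≤ t) (ht : t < 3) :
    ∑ i, m i * Real.exp (s * f i)
      ≤ Real.exp (s * ∑ i, m i * f i + s ^ 2 * (∑ i, m i * f i ^ 2) / (2 * (1 - t / 3))) := by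
  have h1 : ∑ i, m i * Real.exp (s * f i)
      ≤ ∑ i, m i * (1 + s * f i + (s * f i) ^ 2 / (2 * (1 - t / 3))) :=
    Finset.sum_le_sum fun i _ =>
      mul_le_mul_of_nonneg_left (exp_le_one_add_add_sq (hf i) ht) (hm i)
  have h2 : ∑ i, m i * (1 + s * f i + (s * f i) ^ 2 / (2 * (1 - t / 3)))
      = (s * ∑ i, m i * f i + s ^ 2 * (∑ i, m i * f i ^ 2) / (2 * (1 - t / 3))) + ∑ i, m i := by
    simp only [Finset.mul_sum, Finset.sum_div, ← Finset.sum_add_distrib]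
    exact Finset.sum_congr rfl fun i _ => by ring
  rw [h2, hm1] at h1
  exact h1.trans (Real.add_one_le_exp _)

/-! ### Non-asymptotic strong converse -/

/-- Flipping the noise by the noiseless outcomes exchanges noise vectors and outcome vectors. -/
lemma sum_outcome {n p : ℕ} (S : Finset (Fin p)) (X : Fin n → Fin p → Bool)
    (F : (Fin n → Bool) → ℝ) : ∑ Z, F (outcome S X Z) = ∑ Y, F Y := by
  have hinv : Function.Involutive (outcome S X) := by
    intro Z
    funext i
    simp [outcome]
  exact Equiv.sum_comp (hinv.toPerm _) F

lemma one_sub_condError {n p : ℕ} (ρ a : ℝ) (dec : Decoder n p) (S : Finset (Fin p)) :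
    1 - condError ρ a dec S = ∑ X : Fin n → Fin p → Bool, ∑ Z : Fin n → Bool,
      matrixMass a X * noiseMass ρ Z * (if dec X (outcome S X Z) = S then 1 else 0) := by
  have h : ∑ X : Fin n → Fin p → Bool, ∑ Z : Fin n → Bool,
      matrixMass a X * noiseMass ρ Z = 1 := by
    simp only [← Finset.mul_sum, sum_noiseMass, mul_one, sum_matrixMass]
  rw [condError, sub_eq_iff_eq_add']
  refine h.symm.trans ?_
  simp only [← Finset.sum_add_distrib]
  refine Finset.sum_congr rfl fun X _ => Finset.sum_congr rfl fun Z _ => ?_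
  by_cases hd : dec X (outcome S X Z) = S <;> simp [hd]

lemma errorProb_le_one {n p : ℕ} {ρ ν : ℝ} {k : ℕ} (h0 : 0 ≤ ρ) (h1 : ρ ≤ 1)
    (ha0 : 0 ≤ ν / k) (ha1 : ν / k ≤ 1) (dec : Decoder n p) : errorProb ρ ν k dec ≤ 1 := by
  refine errorProb_le zero_le_one fun S _ => ?_
  have h : 0 ≤ 1 - condError ρ (ν / k) dec S := by
    rw [one_sub_condError]
    exact Finset.sum_nonneg fun X _ => Finset.sum_nonneg fun Z _ =>
      mul_nonneg (mul_nonneg (matrixMass_nonneg ha0 ha1 X) (noiseMass_nonneg h0 h1 Z))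
        (by split_ifs <;> norm_num)
  linarith

/-- Non-asymptotic strong converse: whatever the design, the success probability is bounded by the
probability that the noise is atypically likely, plus a counting term. -/
lemma one_sub_errorProb_le {n p k : ℕ} {ρ ν : ℝ} (h0 : 0 < ρ) (h1 : ρ < 1) (hk : k ≤ p)
    (ha0 : 0 ≤ ν / k) (ha1 : ν / k ≤ 1) (dec : Decoder n p) {s : ℝ} (hs : 0 ≤ s) (γ : ℝ) :
    1 - errorProb ρ ν k dec
      ≤ Real.exp (-(s * γ)) *
          (∑ b, bernoulliMass ρ b * Real.exp (s * Real.log (2 * bernoulliMass ρ b))) ^ n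
        + Real.exp γ / p.choose k := by
  have hM : (0 : ℝ) < p.choose k := by exact_mod_cast Nat.choose_pos hk
  set P := Finset.powersetCard k (Finset.univ : Finset (Fin p)) with hP
  have hPc : (P.card : ℝ) = p.choose k := by simp [hP]
  set E := ∑ b, bernoulliMass ρ b * Real.exp (s * Real.log (2 * bernoulliMass ρ b)) with hE
  -- Here `c` is the indicator of success. If the normalized log-likelihood of the noise is at most
  -- `γ`, the mass is at most `exp γ * 2⁻ⁿ`; otherwise the Chernoff factor is at least one.
  have hpt : ∀ Z : Fin n → Bool, ∀ c : ℝ, (c = 0 ∨ c = 1) → noiseMass ρ Z * c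
      ≤ Real.exp (-(s * γ)) *
          (noiseMass ρ Z * ∏ i, Real.exp (s * Real.log (2 * bernoulliMass ρ (Z i))))
        + Real.exp γ * (1 / 2) ^ n * c := by
    intro Z c hc
    have hexp : ∏ i, Real.exp (s * Real.log (2 * bernoulliMass ρ (Z i)))
        = Real.exp (s * ∑ i, Real.log (2 * bernoulliMass ρ (Z i))) := by
      rw [Finset.mul_sum, Real.exp_sum]
    have hmass : noiseMass ρ Z
        = Real.exp (∑ i, Real.log (2 * bernoulliMass ρ (Z i))) * (1 / 2) ^ n := by
      rw [Real.exp_sum]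
      have : ∀ i, Real.exp (Real.log (2 * bernoulliMass ρ (Z i))) = 2 * bernoulliMass ρ (Z i) :=
        fun i => Real.exp_log (by have := bernoulliMass_pos h0 h1 (Z i); positivity)
      simp only [this, Finset.prod_mul_distrib, Finset.prod_const, Finset.card_univ,
        Fintype.card_fin, noiseMass]
      rw [mul_right_comm, ← mul_pow]; norm_num
    set l := ∑ i, Real.log (2 * bernoulliMass ρ (Z i))
    have hnn := noiseMass_nonneg h0.le h1.le Z
    rw [hexp]
    rcases le_or_gt l γ with hl | hl
    · have h2 : noiseMass ρ Z * c ≤ Real.exp γ * (1 / 2) ^ n * c := by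
        rw [hmass]
        have : 0 ≤ c := by rcases hc with h | h <;> simp [h]
        gcongr
      have : 0 ≤ Real.exp (-(s * γ)) * (noiseMass ρ Z * Real.exp (s * l)) := by positivity
      linarith
    · have h2 : (1 : ℝ) ≤ Real.exp (-(s * γ)) * Real.exp (s * l) := by
        rw [← Real.exp_add]
        exact Real.one_le_exp (by nlinarith)
      have h3 : noiseMass ρ Z * c ≤ noiseMass ρ Z := by
        rcases hc with h | h <;> simp [h, hnn]
      have h4 : 0 ≤ Real.exp γ * (1 / 2) ^ n * c := by
        rcases hc with h | h <;> simp [h]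
        positivity
      nlinarith [mul_le_mul_of_nonneg_left h2 hnn]
  have hX : ∀ X : Fin n → Fin p → Bool,
      ∑ S ∈ P, ∑ Z, noiseMass ρ Z * (if dec X (outcome S X Z) = S then (1 : ℝ) else 0)
        ≤ p.choose k * (Real.exp (-(s * γ)) * E ^ n) + Real.exp γ := by
    intro X
    have hS : ∀ S ∈ P, ∑ Z, noiseMass ρ Z * (if dec X (outcome S X Z) = S then (1 : ℝ) else 0)
        ≤ Real.exp (-(s * γ)) * E ^ n
          + Real.exp γ * (1 / 2) ^ n * ∑ Y, if dec X Y = S then (1 : ℝ) else 0 := by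
      intro S _
      rw [← sum_outcome S X fun Y => if dec X Y = S then (1 : ℝ) else 0, Finset.mul_sum]
      have : E ^ n = ∑ Z : Fin n → Bool, noiseMass ρ Z *
          ∏ i, Real.exp (s * Real.log (2 * bernoulliMass ρ (Z i))) := by
        rw [sum_noiseMass_mul ρ fun _ b => Real.exp (s * Real.log (2 * bernoulliMass ρ b))]
        simp [hE]
      rw [this, Finset.mul_sum, ← Finset.sum_add_distrib]
      exact Finset.sum_le_sum fun Z _ => hpt Z (if dec X (outcome S X Z) = S then 1 else 0)
        (by split_ifs <;> simp)
    refine (Finset.sum_le_sum hS).trans ?_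
    rw [Finset.sum_add_distrib, Finset.sum_const, nsmul_eq_mul, hPc, ← Finset.mul_sum,
      Finset.sum_comm]
    -- The counting step: an outcome vector is decoded to a single set.
    have h5 : ∑ Y : Fin n → Bool, ∑ S ∈ P, (if dec X Y = S then (1 : ℝ) else 0) ≤ 2 ^ n := by
      calc _ ≤ ∑ Y : Fin n → Bool, (1 : ℝ) := by
            refine Finset.sum_le_sum fun Y _ => ?_
            rw [Finset.sum_ite_eq]
            split_ifs <;> norm_num
        _ = 2 ^ n := by simp
    have h6 : Real.exp γ * (1 / 2) ^ n *
        ∑ Y : Fin n → Bool, ∑ S ∈ P, (if dec X Y = S then (1 : ℝ) else 0) ≤ Real.exp γ := by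
      calc _ ≤ Real.exp γ * (1 / 2) ^ n * 2 ^ n := by gcongr
        _ = Real.exp γ := by rw [mul_assoc, ← mul_pow]; norm_num
    linarith
  have hid : 1 - errorProb ρ ν k dec = (p.choose k : ℝ)⁻¹ * ∑ X : Fin n → Fin p → Bool,
      matrixMass (ν / k) X *
        ∑ S ∈ P, ∑ Z, noiseMass ρ Z * (if dec X (outcome S X Z) = S then (1 : ℝ) else 0) := by
    have hone : (p.choose k : ℝ)⁻¹ * ∑ S ∈ P, (1 : ℝ) = 1 := by
      rw [Finset.sum_const, nsmul_eq_mul, hPc]; field_simp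
    rw [errorProb_eq, sub_eq_iff_eq_add']
    refine hone.symm.trans ?_
    rw [← mul_add]
    congr 1
    rw [← sub_eq_iff_eq_add', ← Finset.sum_sub_distrib]
    simp only [one_sub_condError, Finset.mul_sum]
    rw [Finset.sum_comm]
    simp only [mul_assoc]
  rw [hid]
  calc _ ≤ (p.choose k : ℝ)⁻¹ * ∑ X : Fin n → Fin p → Bool, matrixMass (ν / k) X *
        (p.choose k * (Real.exp (-(s * γ)) * E ^ n) + Real.exp γ) := by
        gcongr with X _
        · exact matrixMass_nonneg ha0 ha1 X
        · exact hX X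
    _ = _ := by
        rw [← Finset.sum_mul, sum_matrixMass]
        field_simp

/-! ### Likelihood ratios and the threshold decoder -/

lemma hit_union {p : ℕ} (A B : Finset (Fin p)) (x : Fin p → Bool) :
    hit (A ∪ B) x = (hit A x || hit B x) := by
  have h := miss_union A B x
  revert h
  cases hit A x <;> cases hit B x <;> cases hit (A ∪ B) x <;> simp

/-- Probability of the outcome `y` of a test which contains a defective item iff `b` holds. -/
noncomputable def channel (ρ : ℝ) (b y : Bool) : ℝ := bernoulliMass ρ (xor b y)

/-- Law of the outcome when `e` says whether a known defective item takes part and no unknown one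
takes part with probability `u`. -/
noncomputable def outLaw (ρ u : ℝ) (e y : Bool) : ℝ :=
  ∑ d, bernoulliMass (1 - u) d * channel ρ (e || d) y

/-- Likelihood ratio of an outcome, with numerator knowing whether an unknown item takes part. -/
noncomputable def lratio (ρ u : ℝ) (e d y : Bool) : ℝ := channel ρ (e || d) y / outLaw ρ u e y

/-- Likelihood ratio of all outcomes, for the candidate set `S` with known part `S \ T`. -/
noncomputable def likelihood {n p : ℕ} (ρ a : ℝ) (S T : Finset (Fin p)) (X : Fin n → Fin p → Bool)
    (Y : Fin n → Bool) : ℝ :=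
  ∏ i, lratio ρ ((1 - a) ^ T.card) (hit (S \ T) (X i)) (hit T (X i)) (Y i)

/-- All likelihood ratios of the candidate set `S` exceed the thresholds. -/
def Passes {n p : ℕ} (ρ a : ℝ) (γ : ℕ → ℝ) (S : Finset (Fin p)) (X : Fin n → Fin p → Bool)
    (Y : Fin n → Bool) : Prop :=
  ∀ T ⊆ S, T.Nonempty → Real.exp (γ T.card) < likelihood ρ a S T X Y

open Classical in
/-- The decoder which returns a set of size `k` passing all threshold tests. -/
noncomputable def thresholdDecoder {n p : ℕ} (ρ a : ℝ) (k : ℕ) (γ : ℕ → ℝ) : Decoder n p :=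
  fun X Y => if h : ∃ S : Finset (Fin p), S.card = k ∧ Passes ρ a γ S X Y then h.choose else ∅

/-- Moment of the per-test likelihood ratio of the true defective set; `v` and `u` are the
probabilities that no known, respectively no unknown, defective item takes part. -/
noncomputable def ratioMoment (ρ v u s : ℝ) : ℝ :=
  ∑ e, bernoulliMass (1 - v) e * ∑ d, bernoulliMass (1 - u) d *
    ∑ z, bernoulliMass ρ z * Real.exp (-s * Real.log (lratio ρ u e d (xor (e || d) z)))

section
variable {ρ u : ℝ}

lemma channel_pos (h0 : 0 < ρ) (h1 : ρ < 1) (b y : Bool) : 0 < channel ρ b y :=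
  bernoulliMass_pos h0 h1 _

lemma outLaw_pos (h0 : 0 < ρ) (h1 : ρ < 1) (hu0 : 0 ≤ u) (hu1 : u ≤ 1) (e y : Bool) :
    0 < outLaw ρ u e y := by
  have ha := channel_pos h0 h1 (e || true) y
  have hb := channel_pos h0 h1 (e || false) y
  simp only [outLaw, Fintype.sum_bool, bernoulliMass, if_true, Bool.false_eq_true, if_false]
  rcases hu0.eq_or_lt with rfl | hu
  · simpa using ha
  · have : 0 ≤ (1 - u) * channel ρ (e || true) y := mul_nonneg (by linarith) ha.le
    have : 0 < (1 - (1 - u)) * channel ρ (e || false) y := mul_pos (by linarith) hb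
    linarith

lemma lratio_pos (h0 : 0 < ρ) (h1 : ρ < 1) (hu0 : 0 ≤ u) (hu1 : u ≤ 1) (e d y : Bool) :
    0 < lratio ρ u e d y :=
  div_pos (channel_pos h0 h1 _ _) (outLaw_pos h0 h1 hu0 hu1 _ _)

lemma sum_channel (ρ : ℝ) (b : Bool) : ∑ y, channel ρ b y = 1 := by
  cases b <;> simp [channel, bernoulliMass]

/-- The likelihood ratio has mean one if the unknown items are independent of the outcome. -/
lemma sum_lratio_eq_one (h0 : 0 < ρ) (h1 : ρ < 1) (hu0 : 0 ≤ u) (hu1 : u ≤ 1) (e : Bool) :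
    ∑ d, bernoulliMass (1 - u) d * ∑ f, bernoulliMass (1 - u) f *
      ∑ z, bernoulliMass ρ z * lratio ρ u e d (xor (e || f) z) = 1 := by
  have hz : ∀ d f : Bool, ∑ z, bernoulliMass ρ z * lratio ρ u e d (xor (e || f) z)
      = ∑ y, channel ρ (e || f) y * lratio ρ u e d y := by
    intro d f
    cases e <;> cases f <;> simp [channel, add_comm]
  -- Averaging the channel over the independent bit `f` reproduces `outLaw`, which cancels the
  -- denominator of the ratio.
  have hf : ∀ d : Bool, ∑ f, bernoulliMass (1 - u) f *
      ∑ z, bernoulliMass ρ z * lratio ρ u e d (xor (e || f) z) = 1 := by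
    intro d
    refine Eq.trans ?_ (sum_channel ρ (e || d))
    simp only [hz, Finset.mul_sum]
    rw [Finset.sum_comm]
    refine Finset.sum_congr rfl fun y _ => ?_
    simp only [← mul_assoc]
    rw [← Finset.sum_mul]
    exact mul_div_cancel₀ _ (outLaw_pos h0 h1 hu0 hu1 e y).ne'
  simp only [hf, mul_one, sum_bernoulliMass]

end

lemma ratioMoment_nonneg {ρ v u : ℝ} (h0 : 0 < ρ) (h1 : ρ < 1) (hv0 : 0 ≤ v) (hv1 : v ≤ 1)
    (hu0 : 0 ≤ u) (hu1 : u ≤ 1) (s : ℝ) : 0 ≤ ratioMoment ρ v u s := by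
  have hb : ∀ {w : ℝ}, 0 ≤ w → w ≤ 1 → ∀ b, 0 ≤ bernoulliMass (1 - w) b := fun hw0 hw1 b =>
    bernoulliMass_nonneg (by linarith) (by linarith) b
  exact Finset.sum_nonneg fun e _ => mul_nonneg (hb hv0 hv1 e) (Finset.sum_nonneg fun d _ =>
    mul_nonneg (hb hu0 hu1 d) (Finset.sum_nonneg fun z _ =>
      mul_nonneg (bernoulliMass_nonneg h0.le h1.le z) (Real.exp_pos _).le))

section
variable {n p : ℕ} {ρ a : ℝ}

lemma likelihood_pos (h0 : 0 < ρ) (h1 : ρ < 1) (ha0 : 0 ≤ a) (ha1 : a ≤ 1) (S T : Finset (Fin p))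
    (X : Fin n → Fin p → Bool) (Y : Fin n → Bool) : 0 < likelihood ρ a S T X Y :=
  Finset.prod_pos fun _ _ => lratio_pos h0 h1 (pow_nonneg (by linarith) _)
    (pow_le_one₀ (by linarith) (by linarith)) _ _ _

/-- The true defective set fails a threshold test with small probability. -/
lemma sum_likelihood_le (h0 : 0 < ρ) (h1 : ρ < 1) (ha0 : 0 ≤ a) (ha1 : a ≤ 1)
    {S T : Finset (Fin p)} (hT : T ⊆ S) {s : ℝ} (hs : 0 ≤ s) (γ : ℝ) :
    ∑ X : Fin n → Fin p → Bool, ∑ Z : Fin n → Bool, matrixMass a X * noiseMass ρ Z *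
        (if Real.exp γ < likelihood ρ a S T X (outcome S X Z) then 0 else 1)
      ≤ Real.exp (s * γ) *
        ratioMoment ρ ((1 - a) ^ (S.card - T.card)) ((1 - a) ^ T.card) s ^ n := by
  set u := (1 - a) ^ T.card with hu
  have hu0 : 0 ≤ u := pow_nonneg (by linarith) _
  have hu1 : u ≤ 1 := pow_le_one₀ (by linarith) (by linarith)
  have hhit : ∀ x, hit S x = (hit (S \ T) x || hit T x) := by
    intro x
    rw [← hit_union, Finset.sdiff_union_of_subset hT]
  have hM : ratioMoment ρ ((1 - a) ^ (S.card - T.card)) u s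
      = ∑ x, rowMass a x * ∑ z, bernoulliMass ρ z * Real.exp (-s * Real.log
          (lratio ρ u (hit (S \ T) x) (hit T x) (xor (hit S x) z))) := by
    simp only [hhit]
    rw [sum_rowMass_hit a Finset.sdiff_disjoint (Finset.disjoint_empty_right _)
      (Finset.disjoint_empty_right _) (fun e d _ => ∑ z, bernoulliMass ρ z * Real.exp (-s * Real.log
          (lratio ρ u e d (xor (e || d) z)))), Finset.card_sdiff_of_subset hT]
    simp only [← Finset.sum_mul, hitMass, sum_bernoulliMass, one_mul, ← hu, ratioMoment]
  rw [hM, ← sum_matrixMass_noiseMass_mul, Finset.mul_sum]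
  refine Finset.sum_le_sum fun X _ => ?_
  rw [Finset.mul_sum]
  refine Finset.sum_le_sum fun Z _ => ?_
  have hprod : ∏ i, Real.exp (-s * Real.log
      (lratio ρ u (hit (S \ T) (X i)) (hit T (X i)) (xor (hit S (X i)) (Z i))))
      = Real.exp (-s * Real.log (likelihood ρ a S T X (outcome S X Z))) := by
    rw [← Real.exp_sum, ← Finset.mul_sum, likelihood,
      Real.log_prod fun i _ => (lratio_pos h0 h1 hu0 hu1 _ _ _).ne']
    rfl
  rw [hprod, mul_left_comm]
  refine mul_le_mul_of_nonneg_left ?_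
    (mul_nonneg (matrixMass_nonneg ha0 ha1 X) (noiseMass_nonneg h0.le h1.le Z))
  split_ifs with h
  · positivity
  · rw [← Real.exp_add]
    refine Real.one_le_exp ?_
    have hl : Real.log (likelihood ρ a S T X (outcome S X Z)) ≤ γ := by
      rw [Real.log_le_iff_le_exp (likelihood_pos h0 h1 ha0 ha1 _ _ _ _)]
      exact not_lt.1 h
    nlinarith

/-- A wrong set passes a threshold test with small probability. -/
lemma sum_likelihood_wrong_le (h0 : 0 < ρ) (h1 : ρ < 1) (ha0 : 0 ≤ a) (ha1 : a ≤ 1)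
    {S S' : Finset (Fin p)} (hcard : S'.card = S.card) (γ : ℝ) :
    ∑ X : Fin n → Fin p → Bool, ∑ Z : Fin n → Bool, matrixMass a X * noiseMass ρ Z *
        (if Real.exp γ < likelihood ρ a S' (S' \ S) X (outcome S X Z) then 1 else 0)
      ≤ Real.exp (-γ) := by
  set T := S' \ S with hT
  set u := (1 - a) ^ T.card with hu
  have hu0 : 0 ≤ u := pow_nonneg (by linarith) _
  have hu1 : u ≤ 1 := pow_le_one₀ (by linarith) (by linarith)
  have hsd : S' \ T = S' ∩ S := by rw [hT, Finset.sdiff_sdiff_self_left]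
  -- Equal sizes give `hit (S \ S')` and `hit T` the same law, as the mean-one identity requires.
  have hc : (S \ S').card = T.card := by
    rw [hT]; exact Finset.card_sdiff_comm hcard.symm
  have hhit : ∀ x, hit S x = (hit (S' ∩ S) x || hit (S \ S') x) := by
    intro x
    rw [← hit_union, Finset.inter_comm, Finset.union_comm, Finset.sdiff_union_inter]
  have hone : ∑ x, rowMass a x * ∑ z, bernoulliMass ρ z *
      lratio ρ u (hit (S' \ T) x) (hit T x) (xor (hit S x) z) = 1 := by
    simp only [hhit, hsd]
    rw [sum_rowMass_hit a (A := S' ∩ S) (B := T) (D := S \ S') ?_ ?_ ?_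
      (fun e d f => ∑ z, bernoulliMass ρ z * lratio ρ u e d (xor (e || f) z)), hc]
    · simp only [hitMass, ← hu, sum_lratio_eq_one h0 h1 hu0 hu1, mul_one, sum_bernoulliMass]
    · rw [hT]
      exact (Finset.disjoint_sdiff).mono_left Finset.inter_subset_right
    · exact (Finset.disjoint_sdiff).mono_left Finset.inter_subset_left
    · rw [hT]
      exact Finset.sdiff_disjoint.mono_right Finset.sdiff_subset
  have hsum := sum_matrixMass_noiseMass_mul (n := n) a ρ
    (fun x z => lratio ρ u (hit (S' \ T) x) (hit T x) (xor (hit S x) z))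
  rw [hone, one_pow] at hsum
  refine le_of_le_of_eq ?_ ((congrArg _ hsum).trans (mul_one (Real.exp (-γ))))
  rw [Finset.mul_sum]
  refine Finset.sum_le_sum fun X _ => ?_
  rw [Finset.mul_sum]
  refine Finset.sum_le_sum fun Z _ => ?_
  rw [mul_left_comm]
  refine mul_le_mul_of_nonneg_left ?_
    (mul_nonneg (matrixMass_nonneg ha0 ha1 X) (noiseMass_nonneg h0.le h1.le Z))
  change (if Real.exp γ < likelihood ρ a S' T X (outcome S X Z) then (1 : ℝ) else 0)
    ≤ Real.exp (-γ) * likelihood ρ a S' T X (outcome S X Z)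
  have hpos := likelihood_pos h0 h1 ha0 ha1 S' T X (outcome S X Z)
  split_ifs with h
  · calc (1 : ℝ) = Real.exp (-γ) * Real.exp γ := by rw [← Real.exp_add]; simp
      _ ≤ _ := by gcongr
  · positivity

lemma sum_sum_mul_sum {α β κ : Type*} [Fintype α] [Fintype β] (A : Finset κ) (w : α → β → ℝ)
    (f : κ → α → β → ℝ) :
    ∑ x, ∑ y, w x y * ∑ i ∈ A, f i x y = ∑ i ∈ A, ∑ x, ∑ y, w x y * f i x y := by
  simp only [Finset.mul_sum]
  rw [Finset.sum_comm (s := A)]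
  exact Finset.sum_congr rfl fun x _ => Finset.sum_comm

/-- Collects the terms of a union bound by size; upper bounds on the size classes suffice. -/
lemma sum_card_le {α : Type*} {A : Finset α} {c : α → ℕ} {k : ℕ} {N : ℕ → ℕ} {g : ℕ → ℝ}
    (hg : ∀ l, 0 ≤ g l) (hc : ∀ x ∈ A, c x ∈ Finset.Icc 1 k)
    (hN : ∀ l ∈ Finset.Icc 1 k, (A.filter fun x => c x = l).card ≤ N l) :
    ∑ x ∈ A, g (c x) ≤ ∑ l ∈ Finset.Icc 1 k, (N l : ℝ) * g l := by
  rw [← Finset.sum_fiberwise_of_maps_to hc]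
  refine Finset.sum_le_sum fun l hl => ?_
  rw [Finset.sum_congr rfl fun x hx => by rw [(Finset.mem_filter.1 hx).2], Finset.sum_const,
    nsmul_eq_mul]
  have : ((A.filter fun x => c x = l).card : ℝ) ≤ N l := by exact_mod_cast hN l hl
  exact mul_le_mul_of_nonneg_right this (hg l)

/-- The number of sets of the size of `S` which have `l` elements outside of `S`. -/
lemma card_filter_sdiff_le (S : Finset (Fin p)) (l : ℕ) :
    (((Finset.powersetCard S.card (Finset.univ : Finset (Fin p))).erase S).filter
      fun S' => (S' \ S).card = l).card ≤ S.card.choose l * (p - S.card).choose l := by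
  have hcard : (Finset.powersetCard l S ×ˢ Finset.powersetCard l Sᶜ).card
      = S.card.choose l * (p - S.card).choose l := by
    simp [Finset.card_compl]
  rw [← hcard]
  -- With `S` fixed, `S'` is recovered from what it loses and what it gains.
  refine Finset.card_le_card_of_injOn (fun S' => (S \ S', S' \ S)) ?_ ?_
  · intro S' hS'
    simp only [Finset.coe_filter, Finset.mem_erase, Finset.mem_powersetCard, Set.mem_ofPred_eq]
      at hS'
    simp only [Finset.coe_product, Set.mem_prod, Finset.mem_coe, Finset.mem_powersetCard]
    refine ⟨⟨Finset.sdiff_subset, ?_⟩, ?_, hS'.2⟩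
    · rw [Finset.card_sdiff_comm hS'.1.2.2.symm, hS'.2]
    · intro x hx
      simpa using (Finset.mem_sdiff.1 hx).2
  · intro A _ B _ h
    simp only [Prod.mk.injEq] at h
    ext x
    have h1 := Finset.ext_iff.1 h.1 x
    have h2 := Finset.ext_iff.1 h.2 x
    simp only [Finset.mem_sdiff] at h1 h2
    tauto

/-- On an error, either `S` fails one of its tests, or the decoder has chosen another passing set
`S'`, which in particular passes the test for `T = S' \ S`. The two sums are the union bounds over
`T` and over `S'`, and the exponent `s l` may depend on the size. -/
lemma condError_thresholdDecoder_le (h0 : 0 < ρ) (h1 : ρ < 1) (ha0 : 0 ≤ a) (ha1 : a ≤ 1)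
    (γ s : ℕ → ℝ) (hs : ∀ l, 0 ≤ s l) (S : Finset (Fin p)) :
    condError (n := n) ρ a (thresholdDecoder ρ a S.card γ) S
      ≤ ∑ l ∈ Finset.Icc 1 S.card, (S.card.choose l : ℝ) * (Real.exp (s l * γ l) *
          ratioMoment ρ ((1 - a) ^ (S.card - l)) ((1 - a) ^ l) (s l) ^ n)
        + ∑ l ∈ Finset.Icc 1 S.card,
            ((S.card.choose l * (p - S.card).choose l : ℕ) : ℝ) * Real.exp (-γ l) := by
  classical
  set A := S.powerset.filter fun T => T.Nonempty with hA
  set B := (Finset.powersetCard S.card (Finset.univ : Finset (Fin p))).erase S with hB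
  have hmom : ∀ l, 0 ≤ ratioMoment ρ ((1 - a) ^ (S.card - l)) ((1 - a) ^ l) (s l) := by
    have hq : ∀ m : ℕ, 0 ≤ (1 - a) ^ m ∧ (1 - a) ^ m ≤ 1 := fun m =>
      ⟨pow_nonneg (by linarith) _, pow_le_one₀ (by linarith) (by linarith)⟩
    exact fun l => ratioMoment_nonneg h0 h1 (hq _).1 (hq _).2 (hq _).1 (hq _).2 _
  have hpt : ∀ X : Fin n → Fin p → Bool, ∀ Z : Fin n → Bool,
      (if thresholdDecoder ρ a S.card γ X (outcome S X Z) ≠ S then (1 : ℝ) else 0)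
      ≤ ∑ T ∈ A, (if Real.exp (γ T.card) < likelihood ρ a S T X (outcome S X Z) then 0 else 1)
        + ∑ S' ∈ B, (if Real.exp (γ (S' \ S).card) <
            likelihood ρ a S' (S' \ S) X (outcome S X Z) then 1 else 0) := by
    intro X Z
    have hnA : ∀ T ∈ A, (0 : ℝ) ≤
      (if Real.exp (γ T.card) < likelihood ρ a S T X (outcome S X Z) then 0 else 1) :=
      fun T _ => by split_ifs <;> norm_num
    have hnB : ∀ S' ∈ B, (0 : ℝ) ≤ (if Real.exp (γ (S' \ S).card) <
        likelihood ρ a S' (S' \ S) X (outcome S X Z) then 1 else 0) :=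
      fun T _ => by split_ifs <;> norm_num
    by_cases hd : thresholdDecoder ρ a S.card γ X (outcome S X Z) = S
    · simp only [hd, ne_eq, not_true_eq_false, if_false]
      exact add_nonneg (Finset.sum_nonneg hnA) (Finset.sum_nonneg hnB)
    · rw [if_pos hd]
      by_cases hp : Passes ρ a γ S X (outcome S X Z)
      · have hex : ∃ S' : Finset (Fin p), S'.card = S.card ∧ Passes ρ a γ S' X (outcome S X Z) :=
          ⟨S, rfl, hp⟩
        rw [thresholdDecoder, dif_pos hex] at hd
        obtain ⟨hc, hps⟩ := hex.choose_spec
        set S' := hex.choose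
        have hne : (S' \ S).Nonempty := by
          rw [Finset.sdiff_nonempty]
          exact fun hsub => hd (Finset.eq_of_subset_of_card_le hsub hc.ge)
        have hmem : S' ∈ B := by
          simp [hB, hd, hc]
        have := Finset.single_le_sum hnB hmem
        rw [if_pos (hps _ Finset.sdiff_subset hne)] at this
        linarith [Finset.sum_nonneg hnA]
      · simp only [Passes, not_forall] at hp
        obtain ⟨T, hT, hTn, hlt⟩ := hp
        have hmem : T ∈ A := by simp [hA, hT, hTn]
        have := Finset.single_le_sum hnA hmem
        rw [if_neg hlt] at this
        linarith [Finset.sum_nonneg hnB]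
  calc condError (n := n) ρ a (thresholdDecoder ρ a S.card γ) S
      ≤ ∑ X : Fin n → Fin p → Bool, ∑ Z : Fin n → Bool, matrixMass a X * noiseMass ρ Z *
        (∑ T ∈ A, (if Real.exp (γ T.card) < likelihood ρ a S T X (outcome S X Z) then 0 else 1)
        + ∑ S' ∈ B, (if Real.exp (γ (S' \ S).card) <
            likelihood ρ a S' (S' \ S) X (outcome S X Z) then 1 else 0)) :=
        Finset.sum_le_sum fun X _ => Finset.sum_le_sum fun Z _ =>
          mul_le_mul_of_nonneg_left (hpt X Z)
            (mul_nonneg (matrixMass_nonneg ha0 ha1 X) (noiseMass_nonneg h0.le h1.le Z))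
    _ = ∑ T ∈ A, ∑ X : Fin n → Fin p → Bool, ∑ Z : Fin n → Bool,
          matrixMass a X * noiseMass ρ Z *
            (if Real.exp (γ T.card) < likelihood ρ a S T X (outcome S X Z) then 0 else 1)
        + ∑ S' ∈ B, ∑ X : Fin n → Fin p → Bool, ∑ Z : Fin n → Bool,
          matrixMass a X * noiseMass ρ Z * (if Real.exp (γ (S' \ S).card) <
            likelihood ρ a S' (S' \ S) X (outcome S X Z) then 1 else 0) := by
        simp only [mul_add, Finset.sum_add_distrib, sum_sum_mul_sum]
    _ ≤ ∑ T ∈ A, Real.exp (s T.card * γ T.card) *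
          ratioMoment ρ ((1 - a) ^ (S.card - T.card)) ((1 - a) ^ T.card) (s T.card) ^ n
        + ∑ S' ∈ B, Real.exp (-γ (S' \ S).card) := by
        refine add_le_add (Finset.sum_le_sum fun T hT => ?_) (Finset.sum_le_sum fun S' hS' => ?_)
        · exact sum_likelihood_le h0 h1 ha0 ha1
            (Finset.mem_powerset.1 (Finset.mem_filter.1 hT).1) (hs _) _
        · exact sum_likelihood_wrong_le h0 h1 ha0 ha1
            (Finset.mem_powersetCard.1 (Finset.mem_of_mem_erase hS')).2 _
    _ ≤ _ := by
        refine add_le_add (sum_card_le (c := Finset.card) (N := fun l => S.card.choose l)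
          (g := fun l => Real.exp (s l * γ l) *
            ratioMoment ρ ((1 - a) ^ (S.card - l)) ((1 - a) ^ l) (s l) ^ n) ?_ ?_ ?_)
          (sum_card_le (c := fun S' => (S' \ S).card)
            (N := fun l => S.card.choose l * (p - S.card).choose l)
            (g := fun l => Real.exp (-γ l)) ?_ ?_ ?_)
        · exact fun l => mul_nonneg (Real.exp_pos _).le (pow_nonneg (hmom l) _)
        · intro T hT
          obtain ⟨hT1, hT2⟩ := Finset.mem_filter.1 hT
          exact Finset.mem_Icc.2 ⟨hT2.card_pos, Finset.card_le_card (Finset.mem_powerset.1 hT1)⟩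
        · intro l _
          rw [← Finset.card_powersetCard]
          refine Finset.card_le_card fun T hT => ?_
          obtain ⟨hT1, hT2⟩ := Finset.mem_filter.1 hT
          exact Finset.mem_powersetCard.2
            ⟨Finset.mem_powerset.1 (Finset.mem_filter.1 hT1).1, hT2⟩
        · exact fun l => (Real.exp_pos _).le
        · intro S' hS'
          obtain ⟨hne, hm⟩ := Finset.mem_erase.1 hS'
          have hc := (Finset.mem_powersetCard.1 hm).2
          refine Finset.mem_Icc.2 ⟨Finset.card_pos.2 (Finset.sdiff_nonempty.2 fun hsub =>
            hne (Finset.eq_of_subset_of_card_le hsub hc.ge)), ?_⟩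
          rw [← hc]
          exact Finset.card_le_card Finset.sdiff_subset
        · exact fun l _ => card_filter_sdiff_le S l

end

/-! ### Moments of the per-test log-likelihood ratio -/

/-- Probability of a positive outcome if no defective item takes part with probability `u`. -/
noncomputable def posProb (ρ u : ℝ) : ℝ := ρ * u + (1 - ρ) * (1 - u)

/-- Mutual information between the participation and the outcome, if no defective item takes part
with probability `u`. -/
noncomputable def mutualInfo (ρ u : ℝ) : ℝ := Real.binEntropy (posProb ρ u) - Real.binEntropy ρ

/-- Relative entropy between the laws of the outcome of a test with a defective item and of a
test with no defective item with probability `u`. -/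
noncomputable def relEntropy (ρ u : ℝ) : ℝ :=
  (1 - ρ) * (Real.log (1 - ρ) - Real.log (posProb ρ u))
    + ρ * (Real.log ρ - Real.log (1 - posProb ρ u))

/-- Second moment of the per-test log-likelihood ratio. -/
noncomputable def ratioSq (ρ v u : ℝ) : ℝ :=
  ∑ e, bernoulliMass (1 - v) e * ∑ d, bernoulliMass (1 - u) d *
    ∑ z, bernoulliMass ρ z * Real.log (lratio ρ u e d (xor (e || d) z)) ^ 2

section
variable {ρ u v : ℝ}

lemma posProb_eq (ρ u : ℝ) : posProb ρ u = ρ + (1 - u) * (1 - 2 * ρ) := by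
  unfold posProb; ring

lemma posProb_mem (h1 : ρ < 1 / 2) (hu0 : 0 ≤ u) (hu1 : u ≤ 1) :
    ρ ≤ posProb ρ u ∧ posProb ρ u ≤ 1 - ρ := by
  rw [posProb_eq]
  constructor
  · nlinarith
  · nlinarith

lemma outLaw_false_true (ρ u : ℝ) : outLaw ρ u false true = posProb ρ u := by
  simp [outLaw, channel, bernoulliMass, posProb]; ring

lemma outLaw_false_false (ρ u : ℝ) : outLaw ρ u false false = 1 - posProb ρ u := by
  simp [outLaw, channel, bernoulliMass, posProb]; ring

lemma outLaw_true (ρ u : ℝ) (y : Bool) : outLaw ρ u true y = channel ρ true y := by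
  simp [outLaw, bernoulliMass]; ring

/-- A known defective item in the test already fixes the noiseless outcome, so the test is
uninformative. This is the source of the factor `v` in the moments. -/
lemma lratio_true (h0 : 0 < ρ) (h1 : ρ < 1 / 2) (u : ℝ) (d y : Bool) : lratio ρ u true d y = 1 := by
  rw [lratio, outLaw_true, Bool.true_or, div_self (channel_pos h0 (by linarith) _ _).ne']

/-- Expectation of a function of the log-likelihood ratio, term by term. -/
lemma sum_log_lratio (h0 : 0 < ρ) (h1 : ρ < 1 / 2) (v u : ℝ) (F : ℝ → ℝ) :
    ∑ e, bernoulliMass (1 - v) e * ∑ d, bernoulliMass (1 - u) d *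
      ∑ z, bernoulliMass ρ z * F (Real.log (lratio ρ u e d (xor (e || d) z)))
    = (1 - v) * F 0 + v * (u * (ρ * F (Real.log (ρ / posProb ρ u))
        + (1 - ρ) * F (Real.log ((1 - ρ) / (1 - posProb ρ u))))
      + (1 - u) * (ρ * F (Real.log (ρ / (1 - posProb ρ u)))
        + (1 - ρ) * F (Real.log ((1 - ρ) / posProb ρ u)))) := by
  simp only [Fintype.sum_bool, lratio_true h0 h1]
  simp only [lratio, Bool.false_or, Bool.xor_true, Bool.xor_false, Bool.not_true, Bool.not_false,
    outLaw_false_true, outLaw_false_false]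
  simp [channel, bernoulliMass]
  ring

lemma mean_log_lratio (h0 : 0 < ρ) (h1 : ρ < 1 / 2) (hu0 : 0 ≤ u) (hu1 : u ≤ 1) (v : ℝ) :
    ∑ e, bernoulliMass (1 - v) e * ∑ d, bernoulliMass (1 - u) d *
      ∑ z, bernoulliMass ρ z * Real.log (lratio ρ u e d (xor (e || d) z))
    = v * mutualInfo ρ u := by
  have hw := posProb_mem h1 hu0 hu1
  rw [sum_log_lratio h0 h1 v u fun r => r]
  have hw0 : posProb ρ u ≠ 0 := by linarith
  have hw1 : 1 - posProb ρ u ≠ 0 := by linarith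
  have hr : 1 - ρ ≠ 0 := by linarith
  rw [Real.log_div h0.ne' hw0, Real.log_div hr hw1, Real.log_div h0.ne' hw1, Real.log_div hr hw0,
    mutualInfo, Real.binEntropy, Real.binEntropy]
  simp only [Real.log_inv]
  generalize Real.log (posProb ρ u) = A
  generalize Real.log (1 - posProb ρ u) = B
  rw [posProb]
  ring

lemma abs_log_div_le (h0 : 0 < ρ) {b c : ℝ} (hb : ρ ≤ b ∧ b ≤ 1 - ρ)
    (hc : ρ ≤ c ∧ c ≤ 1 - ρ) : |Real.log (b / c)| ≤ Real.log ((1 - ρ) / ρ) := by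
  have hb0 : 0 < b := by linarith
  have hc0 : 0 < c := by linarith
  have hr : 0 < 1 - ρ := by linarith
  rw [Real.log_div hb0.ne' hc0.ne', Real.log_div hr.ne' h0.ne']
  have e1 := Real.log_le_log h0 hb.1
  have e2 := Real.log_le_log hb0 hb.2
  have e3 := Real.log_le_log h0 hc.1
  have e4 := Real.log_le_log hc0 hc.2
  rw [abs_le]
  constructor <;> linarith

lemma abs_log_lratio_le (h0 : 0 < ρ) (h1 : ρ < 1 / 2) (hu0 : 0 ≤ u) (hu1 : u ≤ 1) (e d y : Bool) :
    |Real.log (lratio ρ u e d y)| ≤ Real.log ((1 - ρ) / ρ) := by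
  have hL : 0 ≤ Real.log ((1 - ρ) / ρ) := Real.log_nonneg (by rw [le_div_iff₀ h0]; linarith)
  have hw := posProb_mem h1 hu0 hu1
  cases e
  · have hc : ρ ≤ channel ρ (false || d) y ∧ channel ρ (false || d) y ≤ 1 - ρ := by
      cases d <;> cases y <;> simp [channel, bernoulliMass] <;> linarith
    cases y
    · rw [lratio, outLaw_false_false]
      exact abs_log_div_le h0 hc ⟨by linarith, by linarith⟩
    · rw [lratio, outLaw_false_true]
      exact abs_log_div_le h0 hc hw
  · rw [lratio_true h0 h1]; simpa using hL

lemma ratioMoment_le (h0 : 0 < ρ) (h1 : ρ < 1 / 2) (hu0 : 0 ≤ u) (hu1 : u ≤ 1) (hv0 : 0 ≤ v)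
    (hv1 : v ≤ 1) {s t : ℝ} (hs : 0 ≤ s) (hst : s * Real.log ((1 - ρ) / ρ) ≤ t) (ht : t < 3) :
    ratioMoment ρ v u s
      ≤ Real.exp (-s * (v * mutualInfo ρ u) + s ^ 2 * ratioSq ρ v u / (2 * (1 - t / 3))) := by
  -- The nested sums become one sum over a product law, the form needed by `sum_mul_exp_le`.
  have hexp : ∀ F : Bool → Bool → Bool → ℝ,
      ∑ e, bernoulliMass (1 - v) e * ∑ d, bernoulliMass (1 - u) d *
        ∑ z, bernoulliMass ρ z * F e d z
      = ∑ i : Bool × Bool × Bool,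
        (bernoulliMass (1 - v) i.1 * bernoulliMass (1 - u) i.2.1 * bernoulliMass ρ i.2.2) *
          F i.1 i.2.1 i.2.2 := by
    intro F
    simp only [Fintype.sum_prod_type, Finset.mul_sum, mul_assoc]
  have hb : ∀ {w : ℝ}, 0 ≤ w → w ≤ 1 → ∀ b, 0 ≤ bernoulliMass (1 - w) b := fun hw0 hw1 b =>
    bernoulliMass_nonneg (by linarith) (by linarith) b
  rw [← mean_log_lratio h0 h1 hu0 hu1 v, ratioSq, ratioMoment,
    hexp fun e d z => Real.exp (-s * Real.log (lratio ρ u e d (xor (e || d) z))),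
    hexp fun e d z => Real.log (lratio ρ u e d (xor (e || d) z)),
    hexp fun e d z => Real.log (lratio ρ u e d (xor (e || d) z)) ^ 2, ← neg_sq s]
  refine sum_mul_exp_le (fun i => ?_) ?_ (fun i => ?_) ht
  · exact mul_nonneg (mul_nonneg (hb hv0 hv1 _) (hb hu0 hu1 _))
      (bernoulliMass_nonneg h0.le (by linarith) _)
  · have := hexp fun _ _ _ => 1
    simp only [mul_one, sum_bernoulliMass] at this
    exact this.symm
  · rw [abs_mul, abs_neg, abs_of_nonneg hs]
    exact (mul_le_mul_of_nonneg_left (abs_log_lratio_le h0 h1 hu0 hu1 _ _ _) hs).trans hst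

/-- To first order in `1 - u` only tests in which an unknown item takes part count: they have weight
`1 - u` and a log-ratio bounded by `log ((1 - ρ) / ρ)`. Without such an item the outcome law differs
from the channel by `O(1 - u)`, so the squared log-ratio is of second order. -/
lemma ratioSq_le (h0 : 0 < ρ) (h1 : ρ < 1 / 2) (hu0 : 0 ≤ u) (hu1 : u ≤ 1) (hv0 : 0 ≤ v) :
    ratioSq ρ v u ≤ v * (1 - u) *
      (Real.log ((1 - ρ) / ρ) ^ 2 + (1 - u) * ((1 - 2 * ρ) / ρ) ^ 2) := by
  have hw := posProb_mem h1 hu0 hu1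
  have hweq := posProb_eq ρ u
  set w := posProb ρ u with hwd
  set L := Real.log ((1 - ρ) / ρ)
  set d := (1 - u) * ((1 - 2 * ρ) / ρ) with hd
  have hd0 : 0 ≤ d := mul_nonneg (by linarith) (div_nonneg (by linarith) h0.le)
  have hdρ : d * ρ = w - ρ := by rw [hd, hweq]; field_simp; ring
  have e1 : Real.log (ρ / w) ^ 2 ≤ d ^ 2 := by
    rw [Real.log_div h0.ne' (by linarith : w ≠ 0), ← neg_sq, neg_sub,
      ← Real.log_div (by linarith : w ≠ 0) h0.ne']
    have hp : 1 ≤ w / ρ := by rw [le_div_iff₀ h0]; linarith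
    have h2 := Real.log_le_sub_one_of_pos (show 0 < w / ρ by linarith)
    have h3 : w / ρ - 1 = d := by field_simp; linarith
    have := Real.log_nonneg hp
    gcongr
    linarith
  have e2 : Real.log ((1 - ρ) / (1 - w)) ^ 2 ≤ d ^ 2 := by
    have hw1 : 0 < 1 - w := by linarith
    have hp : 1 ≤ (1 - ρ) / (1 - w) := by rw [le_div_iff₀ hw1]; linarith
    have h2 := Real.log_le_sub_one_of_pos (show 0 < (1 - ρ) / (1 - w) by linarith)
    have h3 : (1 - ρ) / (1 - w) - 1 ≤ d := by
      rw [sub_le_iff_le_add, div_le_iff₀ hw1]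
      nlinarith
    have := Real.log_nonneg hp
    gcongr
    linarith
  have hm : ρ ≤ 1 - w ∧ 1 - w ≤ 1 - ρ := ⟨by linarith, by linarith⟩
  have e3 : Real.log (ρ / (1 - w)) ^ 2 ≤ L ^ 2 := by
    rw [← sq_abs]
    have := abs_log_div_le h0 (b := ρ) ⟨le_rfl, by linarith⟩ hm
    gcongr
  have e4 : Real.log ((1 - ρ) / w) ^ 2 ≤ L ^ 2 := by
    rw [← sq_abs]
    have := abs_log_div_le h0 (b := 1 - ρ) ⟨by linarith, le_rfl⟩ hw
    gcongr
  rw [ratioSq, sum_log_lratio h0 h1 v u fun r => r ^ 2]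
  have hr : 0 < 1 - ρ := by linarith
  have hu' : 0 ≤ 1 - u := by linarith
  calc _ ≤ (1 - v) * 0 ^ 2 + v * (u * (ρ * d ^ 2 + (1 - ρ) * d ^ 2)
        + (1 - u) * (ρ * L ^ 2 + (1 - ρ) * L ^ 2)) := by gcongr
    _ = v * (1 * (u * d ^ 2) + (1 - u) * L ^ 2) := by ring
    _ ≤ v * (1 * (1 * d ^ 2) + (1 - u) * L ^ 2) := by gcongr
    _ = _ := by rw [hd]; ring

/-- A crude bound, sufficient when a positive fraction of the items is unknown. -/
lemma ratioSq_le_sq (h0 : 0 < ρ) (h1 : ρ < 1 / 2) (hu0 : 0 ≤ u) (hu1 : u ≤ 1) (hv0 : 0 ≤ v)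
    (hv1 : v ≤ 1) : ratioSq ρ v u ≤ Real.log ((1 - ρ) / ρ) ^ 2 := by
  have hsq : ∀ e d y, Real.log (lratio ρ u e d y) ^ 2 ≤ Real.log ((1 - ρ) / ρ) ^ 2 := by
    intro e d y
    rw [← sq_abs]
    have := abs_log_lratio_le h0 h1 hu0 hu1 e d y
    gcongr
  have hb : ∀ {w : ℝ}, 0 ≤ w → w ≤ 1 → ∀ b, 0 ≤ bernoulliMass (1 - w) b := fun hw0 hw1 b =>
    bernoulliMass_nonneg (by linarith) (by linarith) b
  calc ratioSq ρ v u ≤ ∑ e, bernoulliMass (1 - v) e * ∑ d, bernoulliMass (1 - u) d *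
        ∑ z, bernoulliMass ρ z * Real.log ((1 - ρ) / ρ) ^ 2 :=
        Finset.sum_le_sum fun e _ => mul_le_mul_of_nonneg_left (Finset.sum_le_sum fun d _ =>
          mul_le_mul_of_nonneg_left (Finset.sum_le_sum fun z _ =>
            mul_le_mul_of_nonneg_left (hsq _ _ _) (bernoulliMass_nonneg h0.le (by linarith) _))
            (hb hu0 hu1 _)) (hb hv0 hv1 _)
    _ = _ := by simp only [← Finset.sum_mul, sum_bernoulliMass, one_mul]

lemma relEntropy_one (h0 : 0 < ρ) (h1 : ρ < 1 / 2) :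
    relEntropy ρ 1 = (1 - 2 * ρ) * Real.log ((1 - ρ) / ρ) := by
  rw [relEntropy, Real.log_div (by linarith) h0.ne']
  simp [posProb]
  ring

/-- By strict concavity of the logarithm `relEntropy ρ` is strictly convex in `u`, and it vanishes
at `u = 0`, where `posProb` is `1 - ρ`. The chord from zero therefore has increasing slope; `u₁` is
the convex combination of `u₂` and zero with weight `c`. -/
lemma relEntropy_div_lt (h0 : 0 < ρ) (h1 : ρ < 1 / 2) {u₁ u₂ : ℝ} (hu : 0 < u₁) (h12 : u₁ < u₂)
    (hu2 : u₂ ≤ 1) : relEntropy ρ u₁ / u₁ < relEntropy ρ u₂ / u₂ := by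
  have hu2' : 0 < u₂ := hu.trans h12
  set c := u₁ / u₂ with hc
  have hc0 : 0 < c := div_pos hu hu2'
  have hc1 : c < 1 := (div_lt_one hu2').2 h12
  have hcu : u₁ = c * u₂ := by rw [hc]; field_simp
  have hw := posProb_mem h1 hu2'.le hu2
  have hx : 0 < u₂ * (1 - 2 * ρ) := mul_pos hu2' (by linarith)
  have hne : posProb ρ u₂ ≠ 1 - ρ := by rw [posProb_eq]; linarith
  have l1 := strictConcaveOn_log_Ioi.2 (x := posProb ρ u₂) (y := 1 - ρ)
    (Set.mem_Ioi.2 (by linarith)) (Set.mem_Ioi.2 (by linarith)) hne hc0 (sub_pos.2 hc1) (by ring)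
  have l2 := strictConcaveOn_log_Ioi.2 (x := 1 - posProb ρ u₂) (y := ρ)
    (Set.mem_Ioi.2 (by linarith)) (Set.mem_Ioi.2 h0) (fun h => hne (by linarith)) hc0
    (sub_pos.2 hc1) (by ring)
  have e1 : c • posProb ρ u₂ + (1 - c) • (1 - ρ) = posProb ρ u₁ := by
    rw [hcu]; simp only [smul_eq_mul, posProb]; ring
  have e2 : c • (1 - posProb ρ u₂) + (1 - c) • ρ = 1 - posProb ρ u₁ := by
    rw [hcu]; simp only [smul_eq_mul, posProb]; ring
  rw [e1] at l1
  rw [e2] at l2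
  simp only [smul_eq_mul] at l1 l2
  rw [div_lt_div_iff₀ hu hu2']
  have : relEntropy ρ u₁ < c * relEntropy ρ u₂ := by
    simp only [relEntropy]
    have hr : 0 < 1 - ρ := by linarith
    nlinarith [mul_lt_mul_of_pos_left l1 hr, mul_lt_mul_of_pos_left l2 h0]
  calc relEntropy ρ u₁ * u₂ < c * relEntropy ρ u₂ * u₂ := by gcongr
    _ = relEntropy ρ u₂ * u₁ := by rw [hcu]; ring

/-! ### Concavity of the mutual information in logarithmic scale -/

/-- The mutual information per unit of probability, in the scale `u = exp (-t)`. -/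
noncomputable def scaledInfo (ρ t : ℝ) : ℝ := Real.exp t * mutualInfo ρ (Real.exp (-t))

lemma scaledInfo_zero (ρ : ℝ) : scaledInfo ρ 0 = 0 := by simp [scaledInfo, mutualInfo, posProb]

/-- With `I` for `mutualInfo ρ` and `u = exp (-t)`, the derivative is `(I(u) - u I'(u)) / u`, and
the numerator is exactly the relative entropy. -/
lemma hasDerivAt_scaledInfo (h0 : 0 < ρ) (h1 : ρ < 1 / 2) {t : ℝ} (ht : 0 ≤ t) :
    HasDerivAt (scaledInfo ρ) (relEntropy ρ (Real.exp (-t)) / Real.exp (-t)) t := by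
  set u := Real.exp (-t) with hu
  have hu0 : 0 < u := Real.exp_pos _
  have hu1 : u ≤ 1 := Real.exp_le_one_iff.2 (by linarith)
  have hw := posProb_mem h1 hu0.le hu1
  have hd1 : HasDerivAt (fun t : ℝ => Real.exp (-t)) (-u) t := by
    exact (hasDerivAt_neg t).exp.congr_deriv (by rw [hu]; ring)
  have hd2 : HasDerivAt (posProb ρ) (ρ + (1 - ρ) * (-1)) u := by
    have a := (hasDerivAt_id u).const_mul ρ
    have b := ((hasDerivAt_id u).const_sub 1).const_mul (1 - ρ)
    exact (a.add b).congr_deriv (by ring)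
  have hd3 := (Real.hasDerivAt_binEntropy (p := posProb ρ u) (by linarith) (by linarith))
  have hd4 := ((hd3.comp u hd2).comp t hd1).sub_const (Real.binEntropy ρ)
  have hd5 := (Real.hasDerivAt_exp t).mul hd4
  refine hd5.congr_deriv ?_
  have het : Real.exp t = u⁻¹ := by rw [hu, Real.exp_neg, inv_inv]
  rw [het]
  simp only [Function.comp, ← hu, relEntropy, Real.binEntropy, Real.log_inv]
  generalize Real.log (posProb ρ u) = A
  generalize Real.log (1 - posProb ρ u) = B
  rw [posProb]
  field_simp
  ring

/-- The derivative decreases in `t`: `exp (-t)` decreases, and `relEntropy_div_lt` gives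
monotonicity in `u`. -/
lemma concaveOn_scaledInfo (h0 : 0 < ρ) (h1 : ρ < 1 / 2) :
    ConcaveOn ℝ (Set.Ici 0) (scaledInfo ρ) := by
  refine AntitoneOn.concaveOn_of_deriv (convex_Ici 0)
    (fun t ht => (hasDerivAt_scaledInfo h0 h1 ht).continuousAt.continuousWithinAt)
    (fun t ht => (hasDerivAt_scaledInfo h0 h1
      (interior_subset ht)).differentiableAt.differentiableWithinAt) ?_
  intro s hs t ht hst
  rw [(hasDerivAt_scaledInfo h0 h1 (interior_subset hs)).deriv,
    (hasDerivAt_scaledInfo h0 h1 (interior_subset ht)).deriv]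
  rcases hst.eq_or_lt with rfl | hlt
  · rfl
  · exact (relEntropy_div_lt h0 h1 (Real.exp_pos _) (Real.exp_lt_exp.2 (by linarith))
      (Real.exp_le_one_iff.2 (neg_nonpos.2 (interior_subset hs)))).le

lemma mul_scaledInfo_le (h0 : 0 < ρ) (h1 : ρ < 1 / 2) {c t : ℝ} (hc0 : 0 ≤ c) (hc1 : c ≤ 1)
    (ht : 0 ≤ t) : c * scaledInfo ρ t ≤ scaledInfo ρ (c * t) := by
  have := (concaveOn_scaledInfo h0 h1).2 (Set.mem_Ici.2 ht) (Set.mem_Ici.2 le_rfl) hc0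
    (sub_nonneg.2 hc1) (by ring)
  simpa [scaledInfo_zero] using this

lemma exists_le_scaledInfo (h0 : 0 < ρ) (h1 : ρ < 1 / 2) {ε : ℝ} (hε : 0 < ε) :
    ∃ t₀ > 0, ∀ t, 0 ≤ t → t ≤ t₀ →
      (1 - ε) * ((1 - 2 * ρ) * Real.log ((1 - ρ) / ρ)) * t ≤ scaledInfo ρ t := by
  have hL : 0 < Real.log ((1 - ρ) / ρ) := Real.log_pos (by rw [lt_div_iff₀ h0]; linarith)
  set D := (1 - 2 * ρ) * Real.log ((1 - ρ) / ρ) with hD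
  have hD0 : 0 < D := mul_pos (by linarith) hL
  have hd := hasDerivAt_scaledInfo h0 h1 le_rfl
  rw [neg_zero, Real.exp_zero, div_one, relEntropy_one h0 h1, ← hD] at hd
  have hlo := (hasDerivAt_iff_isLittleO.1 hd).bound (mul_pos hε hD0)
  rw [Metric.eventually_nhds_iff] at hlo
  obtain ⟨r, hr, hball⟩ := hlo
  refine ⟨r / 2, by positivity, fun t ht htr => ?_⟩
  have := hball (y := t) (by rw [Real.dist_eq, sub_zero, abs_of_nonneg ht]; linarith)
  simp only [scaledInfo_zero, sub_zero, smul_eq_mul, Real.norm_eq_abs, abs_of_nonneg ht] at this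
  have := (abs_le.1 this).1
  nlinarith

lemma mutualInfo_half (ρ : ℝ) : mutualInfo ρ (1 / 2) = Real.log 2 - Real.binEntropy ρ := by
  rw [mutualInfo, show posProb ρ (1 / 2) = 2⁻¹ by rw [posProb]; ring, Real.binEntropy_two_inv]

lemma log_two_sub_binEntropy_pos (h1 : ρ < 1 / 2) : 0 < Real.log 2 - Real.binEntropy ρ :=
  sub_pos.2 (Real.binEntropy_lt_log_two.2 (by norm_num; linarith))

/-- Identifying one defective item is easier than identifying a positive fraction of them. -/
lemma log_two_sub_binEntropy_lt (h0 : 0 < ρ) (h1 : ρ < 1 / 2) :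
    Real.log 2 - Real.binEntropy ρ
      < Real.log 2 / 2 * ((1 - 2 * ρ) * Real.log ((1 - ρ) / ρ)) := by
  have hl2 : 0 < Real.log 2 := Real.log_pos (by norm_num)
  -- The mean slope of `scaledInfo` over `[0, log 2]`, where `u` goes from `1` to `1 / 2`, is
  -- attained at an interior point and so is strictly below the slope at zero.
  obtain ⟨c, hc, hslope⟩ := exists_hasDerivAt_eq_slope (scaledInfo ρ)
    (fun t => relEntropy ρ (Real.exp (-t)) / Real.exp (-t)) hl2
    (fun t ht => (hasDerivAt_scaledInfo h0 h1 ht.1).continuousAt.continuousWithinAt)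
    (fun t ht => hasDerivAt_scaledInfo h0 h1 ht.1.le)
  have hlt := relEntropy_div_lt h0 h1 (Real.exp_pos (-c)) (u₂ := 1)
    (Real.exp_lt_one_iff.2 (by linarith [hc.1])) le_rfl
  have hval : scaledInfo ρ (Real.log 2) = 2 * (Real.log 2 - Real.binEntropy ρ) := by
    rw [scaledInfo, Real.exp_neg, Real.exp_log (by norm_num), ← mutualInfo_half]; norm_num
  simp only [hslope, hval, scaledInfo_zero, sub_zero, div_one, relEntropy_one h0 h1] at hlt
  rw [div_lt_iff₀ hl2] at hlt
  linarith

end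

/-! ### Information and variance for `l` of the `k` defective items -/

/-- Mutual information of a test about `l` of the `k` defective items given the others, if each
item stays away from the test with probability `q`. -/
noncomputable def condInfo (ρ q : ℝ) (k l : ℕ) : ℝ := q ^ (k - l) * mutualInfo ρ (q ^ l)

/-- Writing `q ^ (k - l) = q ^ k / q ^ l` puts all sizes `l` on one concave curve, at times
proportional to `l`. -/
lemma condInfo_eq {ρ q : ℝ} (hq : 0 < q) {k l : ℕ} (hl : l ≤ k) :
    condInfo ρ q k l = q ^ k * scaledInfo ρ (l * -Real.log q) := by
  have h : Real.exp (-(l * -Real.log q)) = q ^ l := by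
    rw [mul_neg, neg_neg, mul_comm, Real.exp_mul, Real.exp_log hq, Real.rpow_natCast]
  rw [condInfo, scaledInfo, h, ← neg_neg (l * -Real.log q), Real.exp_neg, h, ← mul_assoc]
  congr 1
  rw [← div_eq_mul_inv, eq_div_iff (pow_pos hq l).ne', ← pow_add, Nat.sub_add_cancel hl]

/-- A concave curve through the origin lies above its chord to the point for `l = k`. -/
lemma le_condInfo {ρ q : ℝ} (h0 : 0 < ρ) (h1 : ρ < 1 / 2) (hq : 0 < q) (hq1 : q ≤ 1) {k l : ℕ}
    (hk : 0 < k) (hl : l ≤ k) : (l / k : ℝ) * mutualInfo ρ (q ^ k) ≤ condInfo ρ q k l := by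
  have hk' : (0 : ℝ) < k := by exact_mod_cast hk
  have hlk : (l : ℝ) ≤ k := by exact_mod_cast hl
  have hkk : mutualInfo ρ (q ^ k) = q ^ k * scaledInfo ρ (k * -Real.log q) := by
    rw [← condInfo_eq hq le_rfl, condInfo, Nat.sub_self, pow_zero, one_mul]
  rw [hkk, condInfo_eq hq hl]
  have := mul_scaledInfo_le h0 h1 (c := l / k) (t := k * -Real.log q) (by positivity)
    ((div_le_one hk').2 hlk) (mul_nonneg hk'.le (neg_nonneg.2 (Real.log_nonpos hq.le hq1)))
  rw [← mul_assoc (l / k : ℝ) (k : ℝ), div_mul_cancel₀ _ hk'.ne'] at this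
  calc (l / k : ℝ) * (q ^ k * scaledInfo ρ (k * -Real.log q))
      = q ^ k * (l / k * scaledInfo ρ (k * -Real.log q)) := by ring
    _ ≤ _ := by gcongr

lemma tendsto_one_sub_div_pow (ν : ℝ) :
    Tendsto (fun k : ℕ => (1 - ν / k) ^ k) atTop (𝓝 (Real.exp (-ν))) := by
  simpa [neg_div, sub_eq_add_neg] using Real.tendsto_one_add_div_pow_exp (-ν)

lemma exp_neg_log_two : Real.exp (-Real.log 2) = 1 / 2 := by
  rw [Real.exp_neg, Real.exp_log (by norm_num)]; norm_num

lemma eventually_log_two_div_mem :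
    ∀ᶠ k : ℕ in atTop, 0 < k ∧ 0 < Real.log 2 / k ∧ Real.log 2 / k < 1 := by
  filter_upwards [eventually_gt_atTop 0] with k hk
  have hk1 : (1 : ℝ) ≤ k := by exact_mod_cast hk
  have hl := Real.log_pos (show (1 : ℝ) < 2 by norm_num)
  have hl2 : Real.log 2 < 1 := by linarith [Real.log_two_lt_d9]
  exact ⟨hk, by positivity, by rw [div_lt_one (by linarith)]; linarith⟩

/-- The information on a set of items is at least proportional to its size. -/
lemma eventually_le_condInfo {ρ : ℝ} (h0 : 0 < ρ) (h1 : ρ < 1 / 2) {ε : ℝ} (hε : 0 < ε) :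
    ∀ᶠ k : ℕ in atTop, ∀ l ≤ k, (1 - ε) * (Real.log 2 - Real.binEntropy ρ) * (l / k)
      ≤ condInfo ρ (1 - Real.log 2 / k) k l := by
  have hC := log_two_sub_binEntropy_pos h1
  have hcont : Continuous (mutualInfo ρ) := by
    unfold mutualInfo posProb; fun_prop
  have ht : Tendsto (fun k : ℕ => mutualInfo ρ ((1 - Real.log 2 / k) ^ k)) atTop
      (𝓝 (Real.log 2 - Real.binEntropy ρ)) := by
    rw [← mutualInfo_half, ← exp_neg_log_two]
    exact (hcont.tendsto _).comp (tendsto_one_sub_div_pow _)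
  filter_upwards [eventually_log_two_div_mem, ht.eventually_const_le
    (show (1 - ε) * (Real.log 2 - Real.binEntropy ρ) < _ by nlinarith)] with k ⟨hk, ha0, ha1⟩ hI l hl
  refine le_trans ?_ (le_condInfo h0 h1 (by linarith) (by linarith) hk hl)
  rw [mul_comm]
  gcongr

/-- Bernoulli's inequality gives `1 - (1 - a) ^ l ≤ l * a`, hence also `(1 - a) ^ (k - l) ≤ (1 / 2)
/ (1 - e)`; both are then put into `ratioSq_le`. -/
lemma ratioSq_pow_le {ρ : ℝ} (h0 : 0 < ρ) (h1 : ρ < 1 / 2) {a e : ℝ} (ha0 : 0 < a) (ha1 : a < 1)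
    {k l : ℕ} (hlk : l ≤ k) (hla : l * a ≤ e) (he : e < 1) (hqk : (1 - a) ^ k ≤ 1 / 2) :
    ratioSq ρ ((1 - a) ^ (k - l)) ((1 - a) ^ l)
      ≤ l * a / 2 * ((Real.log ((1 - ρ) / ρ) ^ 2 + e * ((1 - 2 * ρ) / ρ) ^ 2) / (1 - e)) := by
  have hq0 : 0 < 1 - a := by linarith
  have hql : 1 - (1 - a) ^ l ≤ l * a := by
    have := one_add_mul_le_pow (show (-2 : ℝ) ≤ -a by linarith) l
    rw [← sub_eq_add_neg] at this
    linarith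
  have hql0 : 0 < (1 - a) ^ l := pow_pos hq0 l
  have hql1 : (1 - a) ^ l ≤ 1 := pow_le_one₀ hq0.le (by linarith)
  refine (ratioSq_le h0 h1 hql0.le hql1 (pow_nonneg hq0.le _)).trans ?_
  have hden : 0 < 1 - e := by linarith
  have hv0 : 0 ≤ (1 - a) ^ (k - l) := pow_nonneg hq0.le _
  have hqkl : (1 - a) ^ (k - l) ≤ 1 / 2 / (1 - e) := by
    rw [le_div_iff₀ hden]
    calc (1 - a) ^ (k - l) * (1 - e) ≤ (1 - a) ^ (k - l) * (1 - a) ^ l :=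
          mul_le_mul_of_nonneg_left (by linarith) hv0
      _ = (1 - a) ^ k := by rw [← pow_add, Nat.sub_add_cancel hlk]
      _ ≤ 1 / 2 := hqk
  have hla0 : 0 ≤ l * a := by positivity
  have h3 : (1 - (1 - a) ^ l) * ((1 - 2 * ρ) / ρ) ^ 2 ≤ e * ((1 - 2 * ρ) / ρ) ^ 2 :=
    mul_le_mul_of_nonneg_right (hql.trans hla) (sq_nonneg _)
  have h4 : 0 ≤ (1 - (1 - a) ^ l) * ((1 - 2 * ρ) / ρ) ^ 2 :=
    mul_nonneg (by linarith) (sq_nonneg _)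
  have h5 : 0 ≤ 1 / 2 / (1 - e) := by positivity
  calc _ ≤ 1 / 2 / (1 - e) * (l * a) *
        (Real.log ((1 - ρ) / ρ) ^ 2 + e * ((1 - 2 * ρ) / ρ) ^ 2) := by
        refine mul_le_mul (mul_le_mul hqkl hql (by linarith) h5) (by linarith) ?_ (by positivity)
        linarith [sq_nonneg (Real.log ((1 - ρ) / ρ))]
    _ = _ := by ring

/-- Mean and second moment of the log-likelihood ratio for a small fraction of unknown items. -/
lemma exists_condInfo_sparse {ρ : ℝ} (h0 : 0 < ρ) (h1 : ρ < 1 / 2) {ε : ℝ} (hε : 0 < ε)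
    (hε1 : ε ≤ 1) :
    ∃ ε₁ > 0, ε₁ ≤ 1 ∧ ∀ᶠ k : ℕ in atTop, ∀ l : ℕ, (l : ℝ) ≤ ε₁ * k →
      (1 - ε) * (Real.log 2 / 2 * (l / k)) * ((1 - 2 * ρ) * Real.log ((1 - ρ) / ρ))
        ≤ condInfo ρ (1 - Real.log 2 / k) k l ∧
      ratioSq ρ ((1 - Real.log 2 / k) ^ (k - l)) ((1 - Real.log 2 / k) ^ l)
        ≤ (1 + ε) * (Real.log 2 / 2 * (l / k)) * Real.log ((1 - ρ) / ρ) ^ 2 := by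
  have hL : 0 < Real.log ((1 - ρ) / ρ) := Real.log_pos (by rw [lt_div_iff₀ h0]; linarith)
  have hν := Real.log_pos (show (1 : ℝ) < 2 by norm_num)
  have hν1 : Real.log 2 < 1 := by linarith [Real.log_two_lt_d9]
  have hx : 0 < 1 - 2 * ρ := by linarith
  set L := Real.log ((1 - ρ) / ρ) with hLd
  set x := 1 - 2 * ρ with hxd
  set ν := Real.log 2 with hνd
  obtain ⟨t₀, ht₀, hpsi⟩ := exists_le_scaledInfo h0 h1 (half_pos hε)
  have hcont : Tendsto (fun e : ℝ => (L ^ 2 + e * ν * (x / ρ) ^ 2) / (1 - e * ν)) (𝓝[>] 0)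
      (𝓝 (L ^ 2)) := by
    have : ContinuousAt (fun e : ℝ => (L ^ 2 + e * ν * (x / ρ) ^ 2) / (1 - e * ν)) 0 :=
      ContinuousAt.div (by fun_prop) (by fun_prop) (by simp)
    have h := this.tendsto.mono_left (nhdsWithin_le_nhds (s := Set.Ioi 0))
    simpa using h
  have hlt : L ^ 2 < (1 + ε) * L ^ 2 := by nlinarith [pow_pos hL 2]
  -- `ε₁` is small enough for the second-moment factor to be within `1 + ε` of its limit, and for `l
  -- * -log q ≤ 2 * ν * ε₁` to stay in the linear range `[0, t₀]` of `scaledInfo`.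
  obtain ⟨ε₁, ⟨hsq, hε₁t, hε₁1⟩, hε₁⟩ := (((hcont.eventually_le_const hlt).and
    ((((eventually_lt_nhds (show (0 : ℝ) < t₀ / (2 * ν) by positivity)).and
      (eventually_lt_nhds (show (0 : ℝ) < 1 by norm_num)))).filter_mono nhdsWithin_le_nhds)).and
      eventually_mem_nhdsWithin).exists
  have hε₁0 : 0 < ε₁ := hε₁
  refine ⟨ε₁, hε₁0, hε₁1.le, ?_⟩
  have htq := tendsto_one_sub_div_pow ν
  rw [hνd, exp_neg_log_two] at htq
  have hhalf : (1 - ε / 2) * (1 / 2 : ℝ) < 1 / 2 := by linarith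
  have hlogq : Tendsto (fun k : ℕ => -Real.log ((1 - ν / k) ^ k)) atTop (𝓝 ν) := by
    have h := ((Real.continuousAt_log (show (1 / 2 : ℝ) ≠ 0 by norm_num)).tendsto.comp htq).neg
    have e : -Real.log (1 / 2) = ν := by rw [one_div, Real.log_inv, neg_neg]
    rw [e] at h
    exact h
  filter_upwards [eventually_log_two_div_mem, htq.eventually_const_le hhalf,
    hlogq.eventually_le_const (show ν < 2 * ν by linarith)] with k ⟨hk, ha0, ha1⟩ hqk hlog l hl
  have hk' : (0 : ℝ) < k := by exact_mod_cast hk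
  have hlk : l ≤ k := by
    have : (l : ℝ) ≤ k := hl.trans (by nlinarith)
    exact_mod_cast this
  have hl0 : (0 : ℝ) ≤ l := Nat.cast_nonneg l
  set q := 1 - ν / k with hq
  have hq0 : 0 < q := by linarith
  have hqk2 : q ^ k ≤ 1 / 2 := by
    rw [← exp_neg_log_two, ← hνd]
    calc q ^ k ≤ Real.exp (-(ν / k)) ^ k := by
          gcongr
          rw [hq]
          linarith [Real.add_one_le_exp (-(ν / k))]
      _ = Real.exp (-ν) := by rw [← Real.exp_nat_mul]; congr 1; field_simp
  have hκ : ν / k ≤ -Real.log q := by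
    have := Real.log_le_sub_one_of_pos hq0
    rw [hq] at this ⊢
    linarith
  have hkκ : k * -Real.log q ≤ 2 * ν := by
    rw [Real.log_pow] at hlog
    linarith
  have hκ0 : 0 < -Real.log q := ha0.trans_le hκ
  constructor
  · rw [condInfo_eq hq0 hlk]
    have hle : l * -Real.log q ≤ t₀ := by
      calc l * -Real.log q ≤ ε₁ * k * -Real.log q := by gcongr
        _ = ε₁ * (k * -Real.log q) := by ring
        _ ≤ t₀ / (2 * ν) * (2 * ν) := by gcongr
        _ = t₀ := by field_simp
    have h2 := hpsi _ (by positivity) hle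
    -- One factor pays for `q ^ k` being only near `1 / 2`, the other for the linearization of
    -- `scaledInfo`.
    have hb : (1 - ε) ≤ (1 - ε / 2) * (1 - ε / 2) := by nlinarith
    have h1ε : 0 < 1 - ε / 2 := by linarith
    calc (1 - ε) * (ν / 2 * (l / k)) * (x * L)
        ≤ ((1 - ε / 2) * (1 - ε / 2)) * (ν / 2 * (l / k)) * (x * L) := by gcongr
      _ = ((1 - ε / 2) * (1 / 2)) * ((1 - ε / 2) * (x * L) * (l * (ν / k))) := by ring
      _ ≤ q ^ k * ((1 - ε / 2) * (x * L) * (l * -Real.log q)) := by gcongr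
      _ ≤ q ^ k * scaledInfo ρ (l * -Real.log q) := by gcongr
  · have hlν : l * (ν / k) ≤ ε₁ * ν := by
      calc l * (ν / k) ≤ ε₁ * k * (ν / k) := by gcongr
        _ = ε₁ * ν := by field_simp
    refine (ratioSq_pow_le h0 h1 ha0 ha1 hlk hlν (by nlinarith) hqk2).trans ?_
    calc l * (ν / k) / 2 * ((L ^ 2 + ε₁ * ν * (x / ρ) ^ 2) / (1 - ε₁ * ν))
        ≤ l * (ν / k) / 2 * ((1 + ε) * L ^ 2) :=
          mul_le_mul_of_nonneg_left hsq (by positivity)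
      _ = _ := by ring

/-! ### Growth of `k` and size of the thresholds -/

/-- `k` of order `p ^ θ`, in logarithmic scale. -/
lemma tendsto_log_of_isTheta {θ : ℝ} (hθ0 : 0 < θ) (hθ1 : θ < 1) {k : ℕ → ℕ}
    (hk : (fun p : ℕ => (k p : ℝ)) =Θ[atTop] (fun p : ℕ => (p : ℝ) ^ θ)) :
    Tendsto k atTop atTop ∧
    Tendsto (fun p : ℕ => Real.log ((p : ℝ) / k p)) atTop atTop ∧
    Tendsto (fun p : ℕ => Real.log (k p) / Real.log ((p : ℝ) / k p)) atTop
      (𝓝 (θ / (1 - θ))) ∧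
    Tendsto (fun p : ℕ => Real.log p / Real.log ((p : ℝ) / k p)) atTop (𝓝 (1 / (1 - θ))) := by
  have hp : Tendsto (fun p : ℕ => (p : ℝ)) atTop atTop := tendsto_natCast_atTop_atTop
  have hpow : Tendsto (fun p : ℕ => (p : ℝ) ^ θ) atTop atTop := (tendsto_rpow_atTop hθ0).comp hp
  have hlog : Tendsto (fun p : ℕ => Real.log p) atTop atTop := Real.tendsto_log_atTop.comp hp
  obtain ⟨c₁, hc₁, h1⟩ := hk.1.exists_pos
  obtain ⟨c₂, hc₂, h2⟩ := hk.2.exists_pos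
  have h1' := h1.bound
  have h2' := h2.bound
  have hkr : Tendsto (fun p : ℕ => (k p : ℝ)) atTop atTop := by
    refine tendsto_atTop_mono' _ ?_ (hpow.const_mul_atTop (inv_pos.2 hc₂))
    filter_upwards [h2'] with p hp2
    rw [Real.norm_of_nonneg (by positivity), Real.norm_of_nonneg (by positivity)] at hp2
    rw [inv_mul_le_iff₀ hc₂]
    exact hp2
  have hkp : ∀ᶠ p : ℕ in atTop, (0 : ℝ) < k p := hkr.eventually_gt_atTop 0
  have hpp : ∀ᶠ p : ℕ in atTop, (0 : ℝ) < p := hp.eventually_gt_atTop 0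
  have hratio : Tendsto (fun p : ℕ => Real.log (k p) / Real.log p) atTop (𝓝 θ) := by
    have hu : Tendsto (fun p : ℕ => Real.log c₁ / Real.log p + θ) atTop (𝓝 θ) := by
      simpa using (tendsto_const_nhds.div_atTop hlog).add_const θ
    have hl : Tendsto (fun p : ℕ => θ - Real.log c₂ / Real.log p) atTop (𝓝 θ) := by
      simpa using (tendsto_const_nhds (x := θ)).sub (tendsto_const_nhds.div_atTop hlog)
    refine tendsto_of_tendsto_of_tendsto_of_le_of_le' hl hu ?_ ?_
    · filter_upwards [h2', hkp, hpp, hlog.eventually_gt_atTop 0] with p hp2 hk0 hp0 hl0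
      rw [Real.norm_of_nonneg (by positivity), Real.norm_of_nonneg (by positivity)] at hp2
      have := Real.log_le_log (by positivity) hp2
      rw [Real.log_rpow hp0, Real.log_mul hc₂.ne' hk0.ne'] at this
      rw [sub_le_iff_le_add, ← add_div, le_div_iff₀ hl0]
      linarith
    · filter_upwards [h1', hkp, hpp, hlog.eventually_gt_atTop 0] with p hp2 hk0 hp0 hl0
      rw [Real.norm_of_nonneg (by positivity), Real.norm_of_nonneg (by positivity)] at hp2
      have := Real.log_le_log (by positivity) hp2
      rw [Real.log_mul hc₁.ne' (by positivity), Real.log_rpow hp0] at this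
      rw [div_le_iff₀ hl0, add_mul, div_mul_cancel₀ _ hl0.ne']
      linarith
  have hdiff : Tendsto (fun p : ℕ => Real.log ((p : ℝ) / k p) / Real.log p) atTop
      (𝓝 (1 - θ)) := by
    refine (hratio.const_sub 1).congr' ?_
    filter_upwards [hkp, hpp, hlog.eventually_gt_atTop 0] with p hk0 hp0 hl0
    rw [Real.log_div hp0.ne' hk0.ne', sub_div, div_self hl0.ne']
  have h1θ : 0 < 1 - θ := by linarith
  refine ⟨tendsto_natCast_atTop_iff.1 hkr, ?_, ?_, ?_⟩
  · refine (hdiff.pos_mul_atTop h1θ hlog).congr' ?_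
    filter_upwards [hlog.eventually_gt_atTop 0] with p hl0
    rw [div_mul_cancel₀ _ hl0.ne']
  · refine (hratio.div hdiff h1θ.ne').congr' ?_
    filter_upwards [hlog.eventually_gt_atTop 0] with p hl0
    exact div_div_div_cancel_right₀ hl0.ne' _ _
  · refine ((tendsto_const_nhds (x := (1 : ℝ))).div hdiff h1θ.ne').congr' ?_
    filter_upwards [hlog.eventually_gt_atTop 0] with p hl0
    rw [Pi.div_apply, one_div_div]

/-- The value `x = 0`, where `Real.log` is zero, must be covered: the binomial coefficients in
`threshold` may vanish. -/
lemma log_le_of_le_exp {x y : ℝ} (hx : 0 ≤ x) (hy : 0 ≤ y) (h : x ≤ Real.exp y) :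
    Real.log x ≤ y := by
  rcases hx.eq_or_lt with rfl | hx
  · simpa using hy
  · exact (Real.log_le_iff_le_exp hx).2 h

/-- The threshold for `l` unknown items. -/
noncomputable def threshold (p k l : ℕ) : ℝ :=
  Real.log (((k.choose l * (p - k).choose l : ℕ) : ℝ) * (k : ℝ) ^ 2)

/-- The factor `k ^ 2` in `threshold` serves this bound: summed over the `k` sizes it leaves only `1
/ k`. -/
lemma choose_mul_exp_neg_threshold_le (p k l : ℕ) (hk : 0 < k) :
    ((k.choose l * (p - k).choose l : ℕ) : ℝ) * Real.exp (-threshold p k l) ≤ ((k : ℝ) ^ 2)⁻¹ := by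
  have hk' : (0 : ℝ) < k := by exact_mod_cast hk
  rcases Nat.eq_zero_or_pos (k.choose l * (p - k).choose l) with h | h
  · rw [h]; simp
  · have h' : (0 : ℝ) < ((k.choose l * (p - k).choose l : ℕ) : ℝ) := by exact_mod_cast h
    rw [threshold, Real.exp_neg, Real.exp_log (by positivity)]
    field_simp
    rfl

lemma natCast_choose_le_pow (m l : ℕ) : (m.choose l : ℝ) ≤ (m : ℝ) ^ l := by
  exact_mod_cast Nat.choose_le_pow m l

/-- Each factor is bounded by an `l`-th power: `k ^ l`, `p ^ l` and, crudely, `(k ^ 2) ^ l`, whence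
the coefficient `3 = 1 + 2` of `log k`. -/
lemma threshold_le_sparse {p k l : ℕ} (hk : 0 < k) (hkp : k ≤ p) (hl : 0 < l) :
    threshold p k l ≤ l * (Real.log p + 3 * Real.log k) := by
  have hk1 : (1 : ℝ) ≤ k := by exact_mod_cast hk
  have hp1 : (1 : ℝ) ≤ p := by exact_mod_cast hk.trans_le hkp
  have hlk := Real.log_nonneg hk1
  have hlp := Real.log_nonneg hp1
  refine log_le_of_le_exp (by positivity) (by positivity) ?_
  have he : Real.exp (l * (Real.log p + 3 * Real.log k)) = (k : ℝ) ^ l * (p : ℝ) ^ l *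
      ((k : ℝ) ^ 2) ^ l := by
    rw [Real.exp_nat_mul, Real.exp_add, Real.exp_log (by linarith),
      show 3 * Real.log k = ((3 : ℕ) : ℝ) * Real.log k by norm_num, Real.exp_nat_mul,
      Real.exp_log (by linarith)]
    ring
  rw [he, Nat.cast_mul]
  have h1 := natCast_choose_le_pow k l
  have h2 : ((p - k).choose l : ℝ) ≤ (p : ℝ) ^ l :=
    (natCast_choose_le_pow _ l).trans (by gcongr; exact Nat.sub_le _ _)
  have h3 : (k : ℝ) ^ 2 ≤ ((k : ℝ) ^ 2) ^ l := le_self_pow₀ (one_le_pow₀ hk1) hl.ne'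
  gcongr

/-- Since `l! ≥ l ^ l * exp (-l)` and `l > e * k`, the main coefficient is at most `(p / (k * e)) ^
l * exp l`. The other factors cost at most `exp (3 * k)`, absorbed by `3 * k ≤ l * (3 / e)`, so the
threshold is `l * log (p / k)` up to `O(l)`. -/
lemma threshold_le_dense {p k l : ℕ} {e : ℝ} (he0 : 0 < e) (he1 : e ≤ 1) (hk : 0 < k)
    (hkp : k ≤ p) (hl : e * k < l) :
    threshold p k l ≤ l * (Real.log (p / k) + (3 / e + 1 - Real.log e)) := by
  have hk1 : (1 : ℝ) ≤ k := by exact_mod_cast hk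
  have hk0 : (0 : ℝ) < k := by linarith
  have hp1 : (1 : ℝ) ≤ p := by exact_mod_cast hk.trans_le hkp
  have hl0 : (0 : ℝ) < l := lt_trans (by positivity) hl
  have hpk : (1 : ℝ) ≤ p / k := by rw [le_div_iff₀ hk0, one_mul]; exact_mod_cast hkp
  have hlpk := Real.log_nonneg hpk
  have hle := Real.log_nonpos he0.le he1
  have h3e : 0 < 3 / e := by positivity
  refine log_le_of_le_exp (by positivity) (mul_nonneg hl0.le (by linarith)) ?_
  have h1 : (k.choose l : ℝ) ≤ Real.exp k := by
    have : (k.choose l : ℝ) ≤ 2 ^ k := by exact_mod_cast Nat.choose_le_two_pow k l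
    refine this.trans ?_
    rw [← Real.exp_one_pow]
    gcongr
    exact Real.exp_one_gt_two.le
  have h2 : ((p - k).choose l : ℝ) ≤ Real.exp (l * (Real.log (p / k) + (1 - Real.log e))) := by
    have e1 : ((p - k).choose l : ℝ) ≤ (p : ℝ) ^ l / l.factorial :=
      (Nat.choose_le_pow_div l (p - k)).trans (by gcongr; exact Nat.sub_le _ _)
    have e2 : (l : ℝ) ^ l / l.factorial ≤ Real.exp l := Real.pow_div_factorial_le_exp _ hl0.le l
    have e3 : (p : ℝ) / l ≤ p / k / e := by
      rw [div_div]
      gcongr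
      rw [mul_comm]; exact hl.le
    calc ((p - k).choose l : ℝ) ≤ (p : ℝ) ^ l / l.factorial := e1
      _ = ((p : ℝ) / l) ^ l * ((l : ℝ) ^ l / l.factorial) := by
          rw [div_pow]; field_simp
      _ ≤ (p / k / e) ^ l * Real.exp l := by gcongr
      _ = _ := by
          rw [Real.exp_nat_mul, Real.exp_add, Real.exp_sub, Real.exp_log (by positivity),
            Real.exp_log he0, ← Real.exp_one_pow]
          rw [← mul_pow]; congr 1; ring
  have h3 : (k : ℝ) ^ 2 ≤ Real.exp (2 * k) := by
    rw [show (2 : ℝ) * k = ((2 : ℕ) : ℝ) * k by norm_num, Real.exp_nat_mul]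
    gcongr
    linarith [Real.add_one_le_exp (k : ℝ)]
  rw [Nat.cast_mul]
  calc (k.choose l : ℝ) * ((p - k).choose l : ℝ) * (k : ℝ) ^ 2
      ≤ Real.exp k * Real.exp (l * (Real.log (p / k) + (1 - Real.log e))) * Real.exp (2 * k) := by
        gcongr
    _ = Real.exp (l * (Real.log (p / k) + (1 - Real.log e)) + 3 * k) := by
        rw [← Real.exp_add, ← Real.exp_add]; congr 1; ring
    _ ≤ _ := by
        refine Real.exp_le_exp.2 ?_
        have : 3 * (k : ℝ) ≤ l * (3 / e) := by
          rw [mul_div_assoc', le_div_iff₀ he0]; linarith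
        linarith

/-! ### Failure probability of the true set, for small and large `l / k` -/

/-- Chernoff bound for the true defective set, for a threshold below the mean. -/
lemma exp_mul_ratioMoment_pow_le {ρ u v : ℝ} (h0 : 0 < ρ) (h1 : ρ < 1 / 2) (hu0 : 0 ≤ u)
    (hu1 : u ≤ 1) (hv0 : 0 ≤ v) (hv1 : v ≤ 1) {s t I V δ γ E : ℝ} {n : ℕ} (hs : 0 ≤ s)
    (hst : s * Real.log ((1 - ρ) / ρ) ≤ t) (ht : t < 3) (hI : I = v * mutualInfo ρ u)
    (hV : ratioSq ρ v u ≤ V) (hγ : γ ≤ (1 - δ) * (n * I))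
    (hE : E ≤ n * (s * δ * I - s ^ 2 * V / (2 * (1 - t / 3)))) :
    Real.exp (s * γ) * ratioMoment ρ v u s ^ n ≤ Real.exp (-E) := by
  have hm := ratioMoment_le h0 h1 hu0 hu1 hv0 hv1 hs hst ht
  rw [← hI] at hm
  have hm0 := ratioMoment_nonneg h0 (by linarith) hv0 hv1 hu0 hu1 s
  have hden : 0 < 2 * (1 - t / 3) := by linarith
  calc _ ≤ Real.exp (s * γ) * Real.exp (-s * I + s ^ 2 * V / (2 * (1 - t / 3))) ^ n := by
        gcongr
        refine hm.trans (Real.exp_le_exp.2 ?_)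
        gcongr
    _ = Real.exp (s * γ + n * (-s * I + s ^ 2 * V / (2 * (1 - t / 3)))) := by
        rw [← Real.exp_nat_mul, ← Real.exp_add]
    _ ≤ _ := by
        refine Real.exp_le_exp.2 ?_
        have := mul_le_mul_of_nonneg_left hγ hs
        linarith

/-- The requirements on the number of tests behind the two terms of `zeta`. -/
lemma sparse_bounds {δ x L T z η ε b N I D M : ℝ} (hδ0 : 0 < δ) (hδ1 : δ < 1) (hx : 0 < x)
    (hL : 0 < L) (hz : 0 ≤ z) (hη : 0 < η) (hε : ε = η / (6 * (1 + η)))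
    (hN : 0 ≤ N) (hI : (1 - ε) * b * (x * L) ≤ I) (hD : 0 ≤ D)
    (hM1 : 2 * (1 + 1 / 3 * δ * x) * T / (δ ^ 2 * x ^ 2) ≤ M) (hM2 : z / (x * L * (1 - δ)) ≤ M)
    (hNb : (1 + η) * M * D ≤ N * b) :
    z * D ≤ (1 - δ) * (N * I) ∧
    (1 + η / 2) * T * D ≤ N * (δ * x / (1 + δ * x / 3) / L * δ * I
      - (δ * x / (1 + δ * x / 3) / L) ^ 2 * ((1 + ε) * b * L ^ 2) /
        (2 * (1 - δ * x / (1 + δ * x / 3) / 3))) := by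
  have hε0 : 0 < ε := by rw [hε]; positivity
  -- The choice of `ε` gives `(1 - ε) * (1 + η) ≥ 1` for the mean and `(1 - 3 * ε) * (1 + η) = 1 + η
  -- / 2` for the exponent, whose loss is `2 * (1 - ε) - (1 + ε) = 1 - 3 * ε`.
  have hεη : ε * (1 + η) = η / 6 := by rw [hε]; field_simp
  have hε1 : 3 * ε < 1 := by nlinarith
  have hδ' : 0 < 1 - δ := by linarith
  have hxL : 0 < x * L := mul_pos hx hL
  set y := δ * x with hy
  have hy0 : 0 < y := mul_pos hδ0 hx
  constructor
  · have h1 : z ≤ M * (x * L * (1 - δ)) := by rwa [div_le_iff₀ (by positivity)] at hM2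
    have h2 : z * D ≤ M * (x * L * (1 - δ)) * D := by gcongr
    have h3 : z * D ≤ (1 - ε) * (1 + η) * (z * D) :=
      le_mul_of_one_le_left (by positivity) (by linarith)
    calc z * D ≤ (1 - ε) * (1 + η) * (z * D) := h3
      _ ≤ (1 - ε) * (1 + η) * (M * (x * L * (1 - δ)) * D) := by
          refine mul_le_mul_of_nonneg_left h2 (mul_nonneg (by linarith) (by linarith))
      _ = (1 - ε) * (x * L * (1 - δ)) * ((1 + η) * M * D) := by ring
      _ ≤ (1 - ε) * (x * L * (1 - δ)) * (N * b) :=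
          mul_le_mul_of_nonneg_left hNb (mul_nonneg (by linarith) (by positivity))
      _ = (1 - δ) * (N * ((1 - ε) * b * (x * L))) := by ring
      _ ≤ (1 - δ) * (N * I) := by gcongr
  · have h1 : 2 * (1 + y / 3) * T ≤ M * y ^ 2 := by
      rw [div_le_iff₀ (by positivity)] at hM1
      rw [hy]
      linarith
    -- Bernstein's choice `t = y / (1 + y / 3)`: up to `ε` the linear term of the exponent is twice
    -- the quadratic one, leaving `b * y ^ 2 / (2 * (1 + y / 3))`, as in the first term of `zeta`.
    have ht : 1 - y / (1 + y / 3) / 3 = 1 / (1 + y / 3) := by field_simp; ring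
    have hq : (y / (1 + y / 3) / L) ^ 2 * ((1 + ε) * b * L ^ 2) / (2 * (1 - y / (1 + y / 3) / 3))
        = (1 + ε) * b * (y ^ 2 / (2 * (1 + y / 3))) := by
      rw [ht]; field_simp
    have hlin : 2 * (1 - ε) * b * (y ^ 2 / (2 * (1 + y / 3))) ≤ y / (1 + y / 3) / L * δ * I := by
      calc 2 * (1 - ε) * b * (y ^ 2 / (2 * (1 + y / 3)))
          = y / (1 + y / 3) / L * δ * ((1 - ε) * b * (x * L)) := by
            rw [hy]; field_simp
        _ ≤ _ := by gcongr
    rw [hq]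
    set e := y ^ 2 / (2 * (1 + y / 3)) with he
    have he0 : 0 < e := by positivity
    have hTe : T ≤ M * e := by
      rw [he, mul_div_assoc', le_div_iff₀ (by positivity)]
      linarith
    calc (1 + η / 2) * T * D ≤ (1 + η / 2) * (M * e) * D := by gcongr
      _ = (1 - 3 * ε) * e * ((1 + η) * M * D) := by
          have : (1 - 3 * ε) * (1 + η) = 1 + η / 2 := by linarith
          rw [← this]; ring
      _ ≤ (1 - 3 * ε) * e * (N * b) :=
          mul_le_mul_of_nonneg_left hNb (mul_nonneg (by linarith) he0.le)
      _ = N * (2 * (1 - ε) * b * e - (1 + ε) * b * e) := by ring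
      _ ≤ _ := by gcongr

lemma sum_Icc_pow_le {r : ℝ} (h0 : 0 ≤ r) (h1 : r < 1) (k : ℕ) :
    ∑ l ∈ Finset.Icc 1 k, r ^ l ≤ r / (1 - r) := by
  have hr : 0 < 1 - r := by linarith
  have h : (∑ l ∈ Finset.Icc 1 k, r ^ l) * (1 - r) = r - r ^ (k + 1) := by
    induction k with
    | zero => simp
    | succ k ih => rw [Finset.sum_Icc_succ_top (by omega), add_mul, ih]; ring
  rw [le_div_iff₀ hr, h]
  linarith [pow_nonneg h0 (k + 1)]

/-- The error probability of the threshold decoder, from bounds on each failure probability. -/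
lemma errorProb_thresholdDecoder_le {n p k : ℕ} {ρ ν r : ℝ} (h0 : 0 < ρ) (h1 : ρ < 1) (hk : 0 < k)
    (ha0 : 0 ≤ ν / k) (ha1 : ν / k ≤ 1) (s : ℕ → ℝ) (hs : ∀ l, 0 ≤ s l) (hr0 : 0 ≤ r)
    (hr1 : r < 1)
    (h : ∀ l, 0 < l → l ≤ k → (k.choose l : ℝ) * (Real.exp (s l * threshold p k l) *
      ratioMoment ρ ((1 - ν / k) ^ (k - l)) ((1 - ν / k) ^ l) (s l) ^ n)
        ≤ r ^ l + ((k : ℝ) ^ 2)⁻¹) :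
    errorProb ρ ν k (thresholdDecoder (n := n) (p := p) ρ (ν / k) k (threshold p k))
      ≤ r / (1 - r) + 2 * (k : ℝ)⁻¹ := by
  have hk' : (0 : ℝ) < k := by exact_mod_cast hk
  have hsub : 0 < 1 - r := by linarith
  refine errorProb_le (by positivity) fun S hS => ?_
  have hb := condError_thresholdDecoder_le (n := n) h0 h1 ha0 ha1 (threshold p k) s hs S
  rw [hS] at hb
  have hc : ∑ l ∈ Finset.Icc 1 k, ((k : ℝ) ^ 2)⁻¹ = (k : ℝ)⁻¹ := by
    rw [Finset.sum_const, Nat.card_Icc, nsmul_eq_mul, Nat.add_sub_cancel]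
    field_simp
  refine hb.trans ?_
  calc _ ≤ ∑ l ∈ Finset.Icc 1 k, (r ^ l + ((k : ℝ) ^ 2)⁻¹)
        + ∑ l ∈ Finset.Icc 1 k, ((k : ℝ) ^ 2)⁻¹ :=
        add_le_add (Finset.sum_le_sum fun l hl =>
            h l (Finset.mem_Icc.1 hl).1 (Finset.mem_Icc.1 hl).2)
          (Finset.sum_le_sum fun l _ => choose_mul_exp_neg_threshold_le p k l hk)
    _ ≤ _ := by
        rw [Finset.sum_add_distrib, hc]
        linarith [sum_Icc_pow_le hr0 hr1 k]

/-- Failure probability for a small fraction `l / k` of unknown items. -/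
lemma sparse_term_le {ρ θ δ η ε : ℝ} (h0 : 0 < ρ) (h1 : ρ < 1 / 2) (hθ0 : 0 < θ) (hθ1 : θ < 1)
    (hδ0 : 0 < δ) (hδ1 : δ < 1) (hη : 0 < η) (hε : ε = η / (6 * (1 + η))) {p k l n : ℕ}
    (hk : 0 < k) (hkp : k ≤ p) (hl : 0 < l) (ha0 : 0 < Real.log 2 / k) (ha1 : Real.log 2 / k < 1)
    (hI : (1 - ε) * (Real.log 2 / 2 * (l / k)) * ((1 - 2 * ρ) * Real.log ((1 - ρ) / ρ))
        ≤ condInfo ρ (1 - Real.log 2 / k) k l)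
    (hV : ratioSq ρ ((1 - Real.log 2 / k) ^ (k - l)) ((1 - Real.log 2 / k) ^ l)
        ≤ (1 + ε) * (Real.log 2 / 2 * (l / k)) * Real.log ((1 - ρ) / ρ) ^ 2)
    (hΛ : 0 ≤ Real.log ((p : ℝ) / k))
    (hlog1 : Real.log p + 3 * Real.log k ≤ (1 + 4 * θ) / (1 - θ) * Real.log ((p : ℝ) / k))
    (hlog2 : (1 + η / 4) * Real.log k ≤ (1 + η / 2) * (θ / (1 - θ)) * Real.log ((p : ℝ) / k))
    (hn : zeta ρ δ θ * (k * Real.log ((p : ℝ) / k)) * (1 + η) ≤ n) :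
    (k.choose l : ℝ) * (Real.exp (δ * (1 - 2 * ρ) / (1 + δ * (1 - 2 * ρ) / 3) /
        Real.log ((1 - ρ) / ρ) * threshold p k l) *
      ratioMoment ρ ((1 - Real.log 2 / k) ^ (k - l)) ((1 - Real.log 2 / k) ^ l)
        (δ * (1 - 2 * ρ) / (1 + δ * (1 - 2 * ρ) / 3) / Real.log ((1 - ρ) / ρ)) ^ n)
      ≤ Real.exp (-(η / 4 * Real.log k)) ^ l := by
  have hL : 0 < Real.log ((1 - ρ) / ρ) := Real.log_pos (by rw [lt_div_iff₀ h0]; linarith)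
  have hν := Real.log_pos (show (1 : ℝ) < 2 by norm_num)
  have hx : 0 < 1 - 2 * ρ := by linarith
  have hk' : (0 : ℝ) < k := by exact_mod_cast hk
  have hθ' : 0 < 1 - θ := by linarith
  have hD : 0 ≤ (l : ℝ) * Real.log ((p : ℝ) / k) := by positivity
  have hq0 : 0 < 1 - Real.log 2 / k := by linarith
  have hq : ∀ m : ℕ, 0 ≤ (1 - Real.log 2 / k) ^ m ∧ (1 - Real.log 2 / k) ^ m ≤ 1 := fun m =>
    ⟨pow_nonneg hq0.le _, pow_le_one₀ hq0.le (by linarith)⟩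
  have hNb : (1 + η) * max (2 * (1 + 1 / 3 * δ * (1 - 2 * ρ)) * (θ / (1 - θ)) /
        (δ ^ 2 * (1 - 2 * ρ) ^ 2))
      ((1 + 4 * θ) / (1 - θ) / ((1 - 2 * ρ) * Real.log ((1 - ρ) / ρ) * (1 - δ))) *
        (l * Real.log ((p : ℝ) / k)) ≤ n * (Real.log 2 / 2 * (l / k)) := by
    refine le_trans (le_of_eq ?_)
      (mul_le_mul_of_nonneg_right hn (show 0 ≤ Real.log 2 / 2 * ((l : ℝ) / k) by positivity))
    rw [zeta]
    generalize max (_ : ℝ) _ = M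
    field_simp
  obtain ⟨hA, hB⟩ := sparse_bounds (z := (1 + 4 * θ) / (1 - θ)) (T := θ / (1 - θ)) hδ0 hδ1 hx hL
    (by positivity) hη hε (Nat.cast_nonneg n) hI hD (le_max_left _ _)
    (le_max_right _ _) hNb
  set t := δ * (1 - 2 * ρ) / (1 + δ * (1 - 2 * ρ) / 3) with ht
  have hy0 : 0 < δ * (1 - 2 * ρ) := mul_pos hδ0 hx
  have ht3 : t < 3 := by
    rw [ht, div_lt_iff₀ (by positivity)]; linarith
  have hγ : threshold p k l ≤ (1 - δ) * (n * condInfo ρ (1 - Real.log 2 / k) k l) := by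
    refine (threshold_le_sparse hk hkp hl).trans (le_trans ?_ hA)
    calc (l : ℝ) * (Real.log p + 3 * Real.log k)
        ≤ l * ((1 + 4 * θ) / (1 - θ) * Real.log ((p : ℝ) / k)) := by gcongr
      _ = _ := by ring
  have htail := exp_mul_ratioMoment_pow_le h0 h1 (hq l).1 (hq l).2 (hq (k - l)).1 (hq (k - l)).2
    (s := t / Real.log ((1 - ρ) / ρ)) (t := t) (by positivity)
    (div_mul_cancel₀ _ hL.ne').le ht3 rfl hV hγ hB
  have hkl : (k.choose l : ℝ) ≤ Real.exp (l * Real.log k) := by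
    rw [Real.exp_nat_mul, Real.exp_log hk']
    exact natCast_choose_le_pow k l
  calc _ ≤ Real.exp (l * Real.log k) *
        Real.exp (-((1 + η / 2) * (θ / (1 - θ)) * (l * Real.log ((p : ℝ) / k)))) := by
        refine mul_le_mul hkl htail ?_ (Real.exp_pos _).le
        exact mul_nonneg (Real.exp_pos _).le (pow_nonneg (ratioMoment_nonneg h0 (by linarith)
          (hq _).1 (hq _).2 (hq _).1 (hq _).2 _) _)
    _ ≤ _ := by
        rw [← Real.exp_add, ← Real.exp_nat_mul]
        refine Real.exp_le_exp.2 ?_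
        -- The exponent beats the number of subsets `T`, at most `exp (l * log k)`, with a surplus
        -- of `η / 4 * log k` per item.
        have := mul_le_mul_of_nonneg_left hlog2 (Nat.cast_nonneg (α := ℝ) l)
        linarith

/-- Failure probability for a positive fraction `l / k` of unknown items. -/
lemma dense_term_le {ρ η ε e s : ℝ} (h0 : 0 < ρ) (h1 : ρ < 1 / 2) (hη : 0 < η)
    (hε : ε = η / (6 * (1 + η))) (he0 : 0 < e) (he1 : e ≤ 1) (hs0 : 0 < s)
    (hs1 : s * Real.log ((1 - ρ) / ρ) ≤ 1)
    (hs2 : s * Real.log ((1 - ρ) / ρ) ^ 2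
      ≤ ε * ((1 - ε) * (Real.log 2 - Real.binEntropy ρ) * e) / 2) {p k l n : ℕ}
    (hk : 0 < k) (hkp : k ≤ p) (hl : e * k < l) (ha0 : 0 < Real.log 2 / k)
    (ha1 : Real.log 2 / k < 1)
    (hI : (1 - ε) * (Real.log 2 - Real.binEntropy ρ) * (l / k)
        ≤ condInfo ρ (1 - Real.log 2 / k) k l)
    (hΛ : 0 < Real.log ((p : ℝ) / k))
    (hlog1 : 3 / e + 1 - Real.log e ≤ η / 2 * Real.log ((p : ℝ) / k))
    (hlog2 : 6 * (Real.log 2 - Real.binEntropy ρ) /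
      (s * (ε * ((1 - ε) * (Real.log 2 - Real.binEntropy ρ) * e))) ≤ Real.log ((p : ℝ) / k))
    (hn : 1 / (Real.log 2 - Real.binEntropy ρ) * (k * Real.log ((p : ℝ) / k)) * (1 + η) ≤ n) :
    (k.choose l : ℝ) * (Real.exp (s * threshold p k l) *
      ratioMoment ρ ((1 - Real.log 2 / k) ^ (k - l)) ((1 - Real.log 2 / k) ^ l) s ^ n)
      ≤ ((k : ℝ) ^ 2)⁻¹ := by
  have hC := log_two_sub_binEntropy_pos h1
  have hL : 0 < Real.log ((1 - ρ) / ρ) := Real.log_pos (by rw [lt_div_iff₀ h0]; linarith)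
  set C := Real.log 2 - Real.binEntropy ρ with hCd
  set L := Real.log ((1 - ρ) / ρ) with hLd
  set Λ := Real.log ((p : ℝ) / k) with hΛd
  set I := condInfo ρ (1 - Real.log 2 / k) k l with hId
  have hε0 : 0 < ε := by rw [hε]; positivity
  have hεη : ε * (1 + η) = η / 6 := by rw [hε]; field_simp
  have hε1 : 3 * ε < 1 := by nlinarith
  have hε' : 0 < 1 - ε := by linarith
  have hk' : (0 : ℝ) < k := by exact_mod_cast hk
  have hl0 : (0 : ℝ) < l := lt_trans (by positivity) hl
  have hn0 : (0 : ℝ) ≤ n := Nat.cast_nonneg n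
  have hq0 : 0 < 1 - Real.log 2 / k := by linarith
  have hq : ∀ m : ℕ, 0 ≤ (1 - Real.log 2 / k) ^ m ∧ (1 - Real.log 2 / k) ^ m ≤ 1 := fun m =>
    ⟨pow_nonneg hq0.le _, pow_le_one₀ hq0.le (by linarith)⟩
  have hγ : threshold p k l ≤ (1 - ε) * (n * I) := by
    refine (threshold_le_dense he0 he1 hk hkp hl).trans ?_
    calc (l : ℝ) * (Λ + (3 / e + 1 - Real.log e)) ≤ l * (Λ + η / 2 * Λ) := by gcongr
      _ = (1 + η / 2) * (l * Λ) := by ring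
      _ ≤ ((1 - ε) * (1 - ε) * (1 + η)) * (l * Λ) := by
          refine mul_le_mul_of_nonneg_right ?_ (by positivity)
          have h3 : (1 - 2 * ε) * (1 + η) ≤ (1 - ε) * (1 - ε) * (1 + η) := by
            refine mul_le_mul_of_nonneg_right ?_ (by linarith)
            nlinarith [sq_nonneg ε]
          linarith
      _ = (1 - ε) * ((1 / C * (k * Λ) * (1 + η)) * ((1 - ε) * C * (l / k))) := by
          field_simp
      _ ≤ (1 - ε) * (n * I) := by gcongr
  set i₀ := (1 - ε) * C * e with hi
  have hi0 : 0 < i₀ := by positivity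
  have hIi : i₀ ≤ I := by
    refine le_trans ?_ hI
    rw [hi]
    gcongr
    rw [le_div_iff₀ hk']; exact hl.le
  -- The exponent must reach `3 * k`: one `k` pays for `k.choose l` and two for `k ^ 2`. It does
  -- because `n` is at least of order `k * Λ` with `Λ` large, while `s` and `i₀` are constants.
  have hE : 3 * (k : ℝ) ≤ n * (s * ε * I - s ^ 2 * L ^ 2 / (2 * (1 - 1 / 3))) := by
    have e1 : s * (ε * i₀) / 2 ≤ s * ε * I - s ^ 2 * L ^ 2 / (2 * (1 - 1 / 3)) := by
      have a1 : s * ε * i₀ ≤ s * ε * I := by gcongr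
      have a2 : s * (s * L ^ 2) ≤ s * (ε * i₀ / 2) := by gcongr
      have a3 : 0 < s * (ε * i₀) := by positivity
      have a4 : s ^ 2 * L ^ 2 / (2 * (1 - 1 / 3)) = 3 / 4 * (s * (s * L ^ 2)) := by ring
      rw [a4]
      linarith
    have e2 : 1 / C * (k * Λ) ≤ n := by
      refine le_trans ?_ hn
      have : 0 ≤ 1 / C * (k * Λ) := by positivity
      nlinarith
    rw [div_le_iff₀ (by positivity)] at hlog2
    calc 3 * (k : ℝ) = 1 / C * k * (6 * C) / 2 := by field_simp; ring
      _ ≤ 1 / C * k * (Λ * (s * (ε * i₀))) / 2 := by gcongr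
      _ = 1 / C * (k * Λ) * (s * (ε * i₀) / 2) := by ring
      _ ≤ _ := by gcongr
  have htail := exp_mul_ratioMoment_pow_le h0 h1 (hq l).1 (hq l).2 (hq (k - l)).1 (hq (k - l)).2
    hs0.le hs1 (by norm_num) rfl (ratioSq_le_sq h0 h1 (hq l).1 (hq l).2 (hq (k - l)).1
      (hq (k - l)).2) hγ hE
  have hkl : (k.choose l : ℝ) ≤ Real.exp k := by
    have : (k.choose l : ℝ) ≤ 2 ^ k := by exact_mod_cast Nat.choose_le_two_pow k l
    refine this.trans ?_
    rw [← Real.exp_one_pow]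
    gcongr
    exact Real.exp_one_gt_two.le
  have h3 : (k : ℝ) ^ 2 ≤ Real.exp (2 * k) := by
    rw [show (2 : ℝ) * k = ((2 : ℕ) : ℝ) * k by norm_num, Real.exp_nat_mul]
    gcongr
    linarith [Real.add_one_le_exp (k : ℝ)]
  calc _ ≤ Real.exp k * Real.exp (-(3 * k)) := by
        refine mul_le_mul hkl htail ?_ (Real.exp_pos _).le
        exact mul_nonneg (Real.exp_pos _).le (pow_nonneg (ratioMoment_nonneg h0 (by linarith)
          (hq _).1 (hq _).2 (hq _).1 (hq _).2 _) _)
    _ = (Real.exp (2 * k))⁻¹ := by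
        rw [← Real.exp_add, ← Real.exp_neg]; congr 1; ring
    _ ≤ _ := by gcongr

/-! ### Achievability for fixed `δ` -/

/-- Achievability, for a fixed value of the parameter `δ`. -/
theorem errorVanishes_of_le {ρ θ δ η : ℝ} (h0 : 0 < ρ) (h1 : ρ < 1 / 2) (hθ0 : 0 < θ) (hθ1 : θ < 1)
    (hδ0 : 0 < δ) (hδ1 : δ < 1) (hη : 0 < η) {k n : ℕ → ℕ}
    (hk : (fun p : ℕ => (k p : ℝ)) =Θ[atTop] (fun p : ℕ => (p : ℝ) ^ θ))
    (hn : ∀ᶠ p : ℕ in atTop, max (zeta ρ δ θ) (1 / (Real.log 2 - Real.binEntropy ρ)) *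
      ((k p : ℝ) * Real.log ((p : ℝ) / (k p : ℝ))) * (1 + η) ≤ (n p : ℝ)) :
    ErrorVanishes ρ (Real.log 2) k n := by
  obtain ⟨hk1, hk2, hk3, hk4⟩ := tendsto_log_of_isTheta hθ0 hθ1 hk
  have hkr : Tendsto (fun p => (k p : ℝ)) atTop atTop := tendsto_natCast_atTop_atTop.comp hk1
  have hC := log_two_sub_binEntropy_pos h1
  have hL : 0 < Real.log ((1 - ρ) / ρ) := Real.log_pos (by rw [lt_div_iff₀ h0]; linarith)
  have hθ' : 0 < 1 - θ := by linarith
  obtain ⟨ε, hε⟩ : ∃ ε, ε = η / (6 * (1 + η)) := ⟨_, rfl⟩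
  have hε0 : 0 < ε := by rw [hε]; positivity
  have hε1 : ε < 1 := by
    rw [hε, div_lt_one (by positivity)]; linarith
  have hε' : 0 < 1 - ε := by linarith
  obtain ⟨e, he0, he1, hsp⟩ := exists_condInfo_sparse h0 h1 hε0 hε1.le
  set s₁ := δ * (1 - 2 * ρ) / (1 + δ * (1 - 2 * ρ) / 3) / Real.log ((1 - ρ) / ρ) with hs₁
  -- For large `l / k` any small constant exponent works; this one keeps the quadratic Bernstein
  -- term below half of the linear one.
  obtain ⟨s₂, hs₂0, hs₂1, hs₂2⟩ : ∃ s₂ > 0, s₂ * Real.log ((1 - ρ) / ρ) ≤ 1 ∧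
      s₂ * Real.log ((1 - ρ) / ρ) ^ 2
        ≤ ε * ((1 - ε) * (Real.log 2 - Real.binEntropy ρ) * e) / 2 := by
    refine ⟨min (1 / Real.log ((1 - ρ) / ρ))
      (ε * ((1 - ε) * (Real.log 2 - Real.binEntropy ρ) * e) / 2 / Real.log ((1 - ρ) / ρ) ^ 2),
      lt_min (by positivity) (by positivity), ?_, ?_⟩
    · rw [← le_div_iff₀ hL]; exact min_le_left _ _
    · rw [← le_div_iff₀ (by positivity)]; exact min_le_right _ _
  have hx : 0 < 1 - 2 * ρ := by linarith
  have hs₁0 : 0 < s₁ := by positivity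
  have hlog1 : ∀ᶠ p : ℕ in atTop, (Real.log p + 3 * Real.log (k p)) / Real.log ((p : ℝ) / k p)
      ≤ (1 + 4 * θ) / (1 - θ) := by
    -- The limit is `(1 + 3 * θ) / (1 - θ)`; the `4 * θ` in `zeta` leaves the strict room needed
    -- here.
    have h := hk4.add (hk3.const_mul 3)
    refine (h.eventually_le_const (u := (1 + 4 * θ) / (1 - θ)) ?_).mono fun p hp => ?_
    · rw [mul_div_assoc', ← add_div]
      gcongr
      norm_num
    · refine le_trans (le_of_eq ?_) hp
      ring
  have hlog2 : ∀ᶠ p : ℕ in atTop, (1 + η / 4) * (Real.log (k p) / Real.log ((p : ℝ) / k p))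
      ≤ (1 + η / 2) * (θ / (1 - θ)) := by
    refine (hk3.const_mul (1 + η / 4)).eventually_le_const ?_
    have : 0 < θ / (1 - θ) := by positivity
    nlinarith
  have hr : Tendsto (fun p => Real.exp (-(η / 4 * Real.log (k p)))) atTop (𝓝 0) := by
    refine Real.tendsto_exp_neg_atTop_nhds_zero.comp ?_
    exact (Real.tendsto_log_atTop.comp hkr).const_mul_atTop (by positivity)
  refine ⟨fun p => thresholdDecoder ρ (Real.log 2 / k p) (k p) (threshold p (k p)), ?_⟩
  have hlim : Tendsto (fun p => Real.exp (-(η / 4 * Real.log (k p))) /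
      (1 - Real.exp (-(η / 4 * Real.log (k p)))) + 2 * (k p : ℝ)⁻¹) atTop (𝓝 0) := by
    have h2 := (hr.div (hr.const_sub 1) (by norm_num)).add
      ((tendsto_inv_atTop_zero.comp hkr).const_mul 2)
    simpa using h2
  refine tendsto_of_tendsto_of_tendsto_of_le_of_le' tendsto_const_nhds hlim ?_ ?_
  · filter_upwards [hk1.eventually eventually_log_two_div_mem] with p ⟨_, ha0, ha1⟩
    exact errorProb_nonneg h0.le (by linarith) ha0.le ha1.le _
  · filter_upwards [hk1.eventually eventually_log_two_div_mem, hk1.eventually hsp,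
      hk1.eventually (eventually_le_condInfo h0 h1 hε0), hk2.eventually_gt_atTop 0,
      hk2.eventually_ge_atTop ((3 / e + 1 - Real.log e) / (η / 2)),
      hk2.eventually_ge_atTop (6 * (Real.log 2 - Real.binEntropy ρ) /
        (s₂ * (ε * ((1 - ε) * (Real.log 2 - Real.binEntropy ρ) * e)))), hlog1, hlog2,
      hr.eventually_lt_const one_pos, hn]
      with p ⟨hkp, ha0, ha1⟩ hsp hden hΛ hb1 hb2 hl1 hl2 hr1 hn
    have hk' : (0 : ℝ) < k p := by exact_mod_cast hkp
    have hkp' : k p ≤ p := by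
      by_contra hcon
      have : Real.log ((p : ℝ) / k p) ≤ 0 := by
        refine Real.log_nonpos (by positivity) ((div_le_one hk').2 ?_)
        exact_mod_cast (not_le.1 hcon).le
      linarith
    have hX : 0 ≤ (k p : ℝ) * Real.log ((p : ℝ) / k p) := by positivity
    rw [div_le_iff₀ hΛ] at hl1
    rw [mul_div_assoc', div_le_iff₀ hΛ] at hl2
    rw [div_le_iff₀ (by positivity)] at hb1
    refine errorProb_thresholdDecoder_le h0 (by linarith) hkp ha0.le ha1.le
      (fun l => if (l : ℝ) ≤ e * k p then s₁ else s₂) (fun l => by split_ifs <;> positivity)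
      (Real.exp_pos _).le hr1 fun l hl hlk => ?_
    by_cases hle : (l : ℝ) ≤ e * k p
    · simp only [hle, if_true]
      obtain ⟨hI, hV⟩ := hsp l hle
      refine (sparse_term_le h0 h1 hθ0 hθ1 hδ0 hδ1 hη hε hkp hkp' hl ha0 ha1 hI hV hΛ.le hl1 hl2
        (le_trans ?_ hn)).trans (le_add_of_nonneg_right (by positivity))
      gcongr
      exact le_max_left _ _
    · simp only [hle, if_false]
      refine (dense_term_le h0 h1 hη hε he0 he1 hs₂0 hs₂1 hs₂2 hkp hkp' (not_le.1 hle) ha0 ha1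
        (hden l hlk) hΛ (by linarith) hb2 (le_trans ?_ hn)).trans
        (le_add_of_nonneg_left (by positivity))
      gcongr
      exact le_max_right _ _

/-! ### Asymptotic strong converse -/

lemma pow_le_pow_mul_choose {p k : ℕ} (hk : k ≤ p) :
    (p : ℝ) ^ k ≤ (k : ℝ) ^ k * p.choose k := by
  induction k generalizing p with
  | zero => simp
  | succ k ih =>
    obtain ⟨m, rfl⟩ : ∃ m, p = m + 1 := ⟨p - 1, by omega⟩
    have hkm : k ≤ m := by omega
    have hch : ((m + 1 : ℕ) : ℝ) * m.choose k = (m + 1).choose (k + 1) * ((k + 1 : ℕ) : ℝ) := by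
      exact_mod_cast Nat.add_one_mul_choose_eq m k
    have hk0 : (0 : ℝ) < ((k + 1 : ℕ) : ℝ) := by positivity
    have hm0 : (0 : ℝ) < ((m + 1 : ℕ) : ℝ) := by positivity
    -- As `k ≤ m`, `(m + 1) / (k + 1) ≤ m / k`, which brings in the induction hypothesis; `k = 0` is
    -- separate because of the division.
    have hkey : (((m + 1 : ℕ) : ℝ) / ((k + 1 : ℕ) : ℝ)) ^ k ≤ m.choose k := by
      rcases Nat.eq_zero_or_pos k with rfl | hk1
      · simp
      · have hk1' : (0 : ℝ) < k := by exact_mod_cast hk1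
        have hkm' : (k : ℝ) ≤ m := by exact_mod_cast hkm
        calc (((m + 1 : ℕ) : ℝ) / ((k + 1 : ℕ) : ℝ)) ^ k ≤ ((m : ℝ) / k) ^ k := by
              refine pow_le_pow_left₀ (by positivity) ?_ k
              rw [div_le_div_iff₀ hk0 hk1']
              push_cast
              nlinarith
          _ ≤ m.choose k := by
              rw [div_pow, div_le_iff₀ (by positivity), mul_comm]
              exact ih hkm
    rw [div_pow, div_le_iff₀ (by positivity)] at hkey
    calc ((m + 1 : ℕ) : ℝ) ^ (k + 1) = ((m + 1 : ℕ) : ℝ) ^ k * ((m + 1 : ℕ) : ℝ) := pow_succ _ _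
      _ ≤ (m.choose k * ((k + 1 : ℕ) : ℝ) ^ k) * ((m + 1 : ℕ) : ℝ) := by gcongr
      _ = ((k + 1 : ℕ) : ℝ) ^ k * (((m + 1 : ℕ) : ℝ) * m.choose k) := by ring
      _ = _ := by rw [hch]; ring

lemma exp_mul_log_div_le_choose {p k : ℕ} (hk0 : 0 < k) (hk : k ≤ p) :
    Real.exp (k * Real.log ((p : ℝ) / k)) ≤ p.choose k := by
  have hk' : (0 : ℝ) < k := by exact_mod_cast hk0
  have hp' : (0 : ℝ) < p := by exact_mod_cast hk0.trans_le hk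
  rw [Real.exp_nat_mul, Real.exp_log (by positivity), div_pow, div_le_iff₀ (by positivity),
    mul_comm]
  exact pow_le_pow_mul_choose hk

/-- Exponential moment of the normalized noise likelihood: its mean is the channel capacity. -/
lemma exists_sum_exp_log_le {ρ : ℝ} (h0 : 0 < ρ) (h1 : ρ < 1 / 2) {c : ℝ} (hc : 0 < c) :
    ∃ s > 0, ∑ b, bernoulliMass ρ b * Real.exp (s * Real.log (2 * bernoulliMass ρ b))
      ≤ Real.exp (s * (Real.log 2 - Real.binEntropy ρ + c)) := by
  set f : Bool → ℝ := fun b => Real.log (2 * bernoulliMass ρ b) with hf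
  set B := |f true| + |f false| + 1 with hB
  set V := ∑ b, bernoulliMass ρ b * f b ^ 2 with hV
  have hm : ∀ b, 0 ≤ bernoulliMass ρ b := bernoulliMass_nonneg h0.le (by linarith)
  have hV0 : 0 ≤ V := Finset.sum_nonneg fun b _ => mul_nonneg (hm b) (sq_nonneg _)
  have hB0 : 0 < B := by positivity
  have hfB : ∀ b, |f b| ≤ B := by
    intro b
    cases b
    · linarith [abs_nonneg (f true)]
    · linarith [abs_nonneg (f false)]
  have hmean : ∑ b, bernoulliMass ρ b * f b = Real.log 2 - Real.binEntropy ρ := by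
    simp only [hf, Fintype.sum_bool, bernoulliMass, if_true, Bool.false_eq_true, if_false]
    rw [Real.log_mul two_ne_zero h0.ne', Real.log_mul two_ne_zero (by linarith),
      Real.binEntropy, Real.log_inv, Real.log_inv]
    ring
  -- The first bound allows `t = 1` in Bernstein's estimate, the second makes the quadratic term at
  -- most `s * c`; the added one avoids dividing by zero.
  set s := min (1 / B) (c / (V + 1)) with hs
  have hs0 : 0 < s := lt_min (by positivity) (by positivity)
  have hsB : s * B ≤ 1 := by rw [← le_div_iff₀ hB0]; exact min_le_left _ _
  have hsV : s * (V + 1) ≤ c := by rw [← le_div_iff₀ (by positivity)]; exact min_le_right _ _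
  refine ⟨s, hs0, (sum_mul_exp_le hm (sum_bernoulliMass ρ) (s := s) (t := 1) (fun b => ?_)
    (by norm_num)).trans (Real.exp_le_exp.2 ?_)⟩
  · rw [abs_mul, abs_of_pos hs0]
    exact (mul_le_mul_of_nonneg_left (hfB b) hs0.le).trans hsB
  · change s * ∑ b, bernoulliMass ρ b * f b + s ^ 2 * V / (2 * (1 - 1 / 3)) ≤ _
    have h2 : s * (s * (V + 1)) ≤ s * c := mul_le_mul_of_nonneg_left hsV hs0.le
    have h3 : 0 ≤ s ^ 2 * V := by positivity
    have h4 : s ^ 2 * V / (2 * (1 - 1 / 3)) = 3 / 4 * (s ^ 2 * V) := by ring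
    rw [hmean, h4]
    nlinarith [sq_nonneg s]

/-- The strong converse. -/
theorem errorTendsToOne_of_le {ρ θ η : ℝ} (h0 : 0 < ρ) (h1 : ρ < 1 / 2) (hθ0 : 0 < θ) (hθ1 : θ < 1)
    (hη : 0 < η) {k n : ℕ → ℕ}
    (hk : (fun p : ℕ => (k p : ℝ)) =Θ[atTop] (fun p : ℕ => (p : ℝ) ^ θ))
    (hn : ∀ᶠ p : ℕ in atTop, (n p : ℝ) ≤ (k p : ℝ) * Real.log ((p : ℝ) / (k p : ℝ))
      / (Real.log 2 - Real.binEntropy ρ) * (1 - η)) :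
    ErrorTendsToOne ρ (Real.log 2) k n := by
  intro dec
  obtain ⟨hk1, hk2, -, -⟩ := tendsto_log_of_isTheta hθ0 hθ1 hk
  have hkr : Tendsto (fun p => (k p : ℝ)) atTop atTop := tendsto_natCast_atTop_atTop.comp hk1
  have hC := log_two_sub_binEntropy_pos h1
  set C := Real.log 2 - Real.binEntropy ρ with hCd
  obtain ⟨s, hs0, hE⟩ := exists_sum_exp_log_le h0 h1 (show 0 < C * (η / 4) by positivity)
  have hX : Tendsto (fun p => (k p : ℝ) * Real.log ((p : ℝ) / k p)) atTop atTop :=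
    hkr.atTop_mul_atTop₀ hk2
  have hlim : Tendsto (fun p => 1 - (Real.exp (-(s * (η / 4) *
        ((k p : ℝ) * Real.log ((p : ℝ) / k p))))
      + Real.exp (-(η / 2 * ((k p : ℝ) * Real.log ((p : ℝ) / k p)))))) atTop (𝓝 1) := by
    have e1 := Real.tendsto_exp_neg_atTop_nhds_zero.comp
      (hX.const_mul_atTop (show 0 < s * (η / 4) by positivity))
    have e2 := Real.tendsto_exp_neg_atTop_nhds_zero.comp
      (hX.const_mul_atTop (show 0 < η / 2 by positivity))
    simpa using (e1.add e2).const_sub 1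
  refine tendsto_of_tendsto_of_tendsto_of_le_of_le' hlim tendsto_const_nhds ?_ ?_
  · filter_upwards [hk1.eventually eventually_log_two_div_mem, hk2.eventually_gt_atTop 0, hn]
      with p ⟨hkp, ha0, ha1⟩ hΛ hn
    have hk' : (0 : ℝ) < k p := by exact_mod_cast hkp
    have hkp' : k p ≤ p := by
      by_contra hcon
      have : Real.log ((p : ℝ) / k p) ≤ 0 := by
        refine Real.log_nonpos (by positivity) ((div_le_one hk').2 ?_)
        exact_mod_cast (not_le.1 hcon).le
      linarith
    have hX0 : 0 < (k p : ℝ) * Real.log ((p : ℝ) / k p) := by positivity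
    have hch := exp_mul_log_div_le_choose hkp hkp'
    set X := (k p : ℝ) * Real.log ((p : ℝ) / k p) with hXd
    -- The threshold `(1 - η / 2) * X` lies between the mean `n * C ≤ (1 - η) * X` of the noise
    -- log-likelihood and `X ≤ log (p.choose k)`, so both terms decay exponentially in `X`.
    have hmain := one_sub_errorProb_le h0 (by linarith) hkp' ha0.le ha1.le (dec p) hs0.le
      ((1 - η / 2) * X)
    have hE0 : 0 ≤ ∑ b, bernoulliMass ρ b * Real.exp (s * Real.log (2 * bernoulliMass ρ b)) :=
      Finset.sum_nonneg fun b _ =>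
        mul_nonneg (bernoulliMass_nonneg h0.le (by linarith) b) (Real.exp_pos _).le
    have hfirst : Real.exp (-(s * ((1 - η / 2) * X))) *
        (∑ b, bernoulliMass ρ b * Real.exp (s * Real.log (2 * bernoulliMass ρ b))) ^ n p
        ≤ Real.exp (-(s * (η / 4) * X)) := by
      calc _ ≤ Real.exp (-(s * ((1 - η / 2) * X))) * Real.exp (s * (C + C * (η / 4))) ^ n p := by
            gcongr
        _ = Real.exp (-(s * ((1 - η / 2) * X)) + n p * (s * (C + C * (η / 4)))) := by
            rw [← Real.exp_nat_mul, ← Real.exp_add]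
        _ ≤ _ := by
            refine Real.exp_le_exp.2 ?_
            have h2 : (n p : ℝ) * (s * (C + C * (η / 4)))
                ≤ X / C * (1 - η) * (s * (C + C * (η / 4))) := by gcongr
            have h3 : X / C * (1 - η) * (s * (C + C * (η / 4)))
                = s * (X * ((1 - η) * (1 + η / 4))) := by field_simp
            have h4 : 0 ≤ s * (X * (η * η)) := by positivity
            nlinarith
    have hsecond : Real.exp ((1 - η / 2) * X) / p.choose (k p) ≤ Real.exp (-(η / 2 * X)) := by
      rw [div_le_iff₀ ((Real.exp_pos _).trans_le hch)]
      calc Real.exp ((1 - η / 2) * X) = Real.exp (-(η / 2 * X)) * Real.exp X := by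
            rw [← Real.exp_add]; congr 1; ring
        _ ≤ _ := by gcongr
    linarith
  · filter_upwards [hk1.eventually eventually_log_two_div_mem] with p ⟨_, ha0, ha1⟩
    exact errorProb_le_one h0.le (by linarith) ha0.le ha1.le _

/-! ### Optimization over `δ` and the sparse regime -/

lemma bddBelow_achConst (ρ θ : ℝ) : BddBelow (Set.range fun δ : Set.Ioo (0 : ℝ) 1 =>
    max (zeta ρ δ θ) (1 / (Real.log 2 - Real.binEntropy ρ))) := by
  refine ⟨1 / (Real.log 2 - Real.binEntropy ρ), ?_⟩
  rintro _ ⟨δ, rfl⟩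
  exact le_max_right _ _

lemma le_achConst (ρ θ : ℝ) : 1 / (Real.log 2 - Real.binEntropy ρ) ≤ achConst ρ θ := by
  have : Nonempty (Set.Ioo (0 : ℝ) 1) := ⟨⟨1 / 2, by norm_num, by norm_num⟩⟩
  exact le_ciInf fun δ => le_max_right _ _

/-- Achievability, optimized over the parameter `δ`. -/
theorem errorVanishes_of_achConst_le {ρ θ η : ℝ} (h0 : 0 < ρ) (h1 : ρ < 1 / 2) (hθ0 : 0 < θ)
    (hθ1 : θ < 1) (hη : 0 < η) {k n : ℕ → ℕ}
    (hk : (fun p : ℕ => (k p : ℝ)) =Θ[atTop] (fun p : ℕ => (p : ℝ) ^ θ))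
    (hn : ∀ᶠ p : ℕ in atTop, achConst ρ θ *
      ((k p : ℝ) * Real.log ((p : ℝ) / (k p : ℝ))) * (1 + η) ≤ (n p : ℝ)) :
    ErrorVanishes ρ (Real.log 2) k n := by
  have : Nonempty (Set.Ioo (0 : ℝ) 1) := ⟨⟨1 / 2, by norm_num, by norm_num⟩⟩
  have hpos : 0 < achConst ρ θ :=
    (one_div_pos.2 (log_two_sub_binEntropy_pos h1)).trans_le (le_achConst ρ θ)
  -- The infimum need not be attained; half of `η` is spent on a near-minimizer.
  have hlt : achConst ρ θ < achConst ρ θ * (1 + η) / (1 + η / 2) := by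
    rw [lt_div_iff₀ (by positivity)]
    nlinarith
  obtain ⟨⟨δ, hδ0, hδ1⟩, hδ⟩ := exists_lt_of_ciInf_lt hlt
  rw [lt_div_iff₀ (by positivity)] at hδ
  refine errorVanishes_of_le h0 h1 hθ0 hθ1 hδ0 hδ1 (half_pos hη) hk ?_
  obtain ⟨-, hk2, -, -⟩ := tendsto_log_of_isTheta hθ0 hθ1 hk
  filter_upwards [hn, hk2.eventually_ge_atTop 0] with p hn hΛ
  refine le_trans ?_ hn
  have hX : 0 ≤ (k p : ℝ) * Real.log ((p : ℝ) / k p) := by positivity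
  rw [mul_right_comm, mul_right_comm (achConst ρ θ)]
  gcongr

/-- In the sparse regime the information-theoretic term dominates. -/
lemma exists_achConst_eq {ρ : ℝ} (h0 : 0 < ρ) (h1 : ρ < 1 / 2) :
    ∃ θ₀ : ℝ, 0 < θ₀ ∧ θ₀ < 1 ∧ ∀ θ : ℝ, 0 < θ → θ < θ₀ →
      achConst ρ θ = 1 / (Real.log 2 - Real.binEntropy ρ) := by
  have hC := log_two_sub_binEntropy_pos h1
  have hlt := log_two_sub_binEntropy_lt h0 h1
  have hν := Real.log_pos (show (1 : ℝ) < 2 by norm_num)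
  have hx : 0 < 1 - 2 * ρ := by linarith
  have hL : 0 < Real.log ((1 - ρ) / ρ) := Real.log_pos (by rw [lt_div_iff₀ h0]; linarith)
  set C := Real.log 2 - Real.binEntropy ρ with hCd
  set D := (1 - 2 * ρ) * Real.log ((1 - ρ) / ρ) with hD
  have hD0 : 0 < D := mul_pos hx hL
  -- Half the relative gap between `C` and `(log 2 / 2) * D`, so that `C < (1 - δ) * ((log 2 / 2) *
  -- D)`. At `θ = 0` this says `zeta < 1 / C`, and continuity in `θ` extends it to small `θ`.
  set δ := (1 - C / (Real.log 2 / 2 * D)) / 2 with hδ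
  have hr0 : 0 < C / (Real.log 2 / 2 * D) := by positivity
  have hr1 : C / (Real.log 2 / 2 * D) < 1 := (div_lt_one (by positivity)).2 hlt
  have hδ0 : 0 < δ := by rw [hδ]; linarith
  have hδ1 : δ < 1 := by rw [hδ]; linarith
  have hδ' : 0 < 1 - δ := by linarith
  have hcont : ContinuousAt (fun θ => zeta ρ δ θ) 0 := by
    unfold zeta
    have hd : ContinuousAt (fun θ : ℝ => 1 - θ) 0 := by fun_prop
    refine ContinuousAt.mul continuousAt_const (Filter.Tendsto.max (ContinuousAt.tendsto ?_)
      (ContinuousAt.tendsto ?_))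
    · exact (continuousAt_const.mul (continuousAt_id.div hd (by norm_num))).div_const _
    · exact (ContinuousAt.div (by fun_prop) hd (by norm_num)).div_const _
  have hzero : zeta ρ δ 0 < 1 / C := by
    have e : zeta ρ δ 0 = 2 / Real.log 2 * (1 / (D * (1 - δ))) := by
      rw [zeta, ← hD]
      have : 0 ≤ 1 / (D * (1 - δ)) := by positivity
      norm_num
      simpa using this
    rw [e, div_mul_div_comm, div_lt_div_iff₀ (by positivity) hC]
    have h4 : C / (Real.log 2 / 2 * D) < 1 - δ := by rw [hδ]; linarith
    have h5 : C < (1 - δ) * (Real.log 2 / 2 * D) := (div_lt_iff₀ (by positivity)).1 h4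
    linarith
  have hev := hcont.eventually_lt continuousAt_const hzero
  obtain ⟨r, hr, hball⟩ := Metric.eventually_nhds_iff.1 hev
  refine ⟨min r (1 / 2), lt_min hr (by norm_num), (min_le_right _ _).trans_lt (by norm_num),
    fun θ hθ0 hθ => le_antisymm ?_ (le_achConst ρ θ)⟩
  have hz := hball (y := θ) (by
    rw [Real.dist_eq, sub_zero, abs_of_pos hθ0]; exact hθ.trans_le (min_le_left _ _))
  refine (ciInf_le (bddBelow_achConst ρ θ) ⟨δ, hδ0, hδ1⟩).trans (max_le hz.le le_rfl)

end NoisyGT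

theorem corollary7 (ρ : ℝ) (hρ0 : 0 < ρ) (hρ1 : ρ < 1 / 2) :
    (∀ θ : ℝ, 0 < θ → θ < 1 → ∀ k : ℕ → ℕ,
      (fun p : ℕ => (k p : ℝ)) =Θ[atTop] (fun p : ℕ => (p : ℝ) ^ θ) →
      ∀ η : ℝ, 0 < η → ∀ n : ℕ → ℕ,
        ((∀ᶠ p : ℕ in atTop,
            NoisyGT.achConst ρ θ * ((k p : ℝ) * Real.log ((p : ℝ) / (k p : ℝ))) * (1 + η)
              ≤ (n p : ℝ)) →
          NoisyGT.ErrorVanishes ρ (Real.log 2) k n) ∧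
        ((∀ᶠ p : ℕ in atTop,
            (n p : ℝ) ≤ (k p : ℝ) * Real.log ((p : ℝ) / (k p : ℝ))
              / (Real.log 2 - Real.binEntropy ρ) * (1 - η)) →
          NoisyGT.ErrorTendsToOne ρ (Real.log 2) k n)) ∧
    (∃ θ₀ : ℝ, 0 < θ₀ ∧ θ₀ < 1 ∧ ∀ θ : ℝ, 0 < θ → θ < θ₀ →
      NoisyGT.achConst ρ θ = 1 / (Real.log 2 - Real.binEntropy ρ) ∧
      ∀ k : ℕ → ℕ,
        (fun p : ℕ => (k p : ℝ)) =Θ[atTop] (fun p : ℕ => (p : ℝ) ^ θ) →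
        NoisyGT.IsExactThreshold ρ (Real.log 2) k
          (fun p : ℕ => (k p : ℝ) * Real.log ((p : ℝ) / (k p : ℝ))
            / (Real.log 2 - Real.binEntropy ρ))) := by
  refine ⟨fun θ hθ0 hθ1 k hk η hη n =>
    ⟨NoisyGT.errorVanishes_of_achConst_le hρ0 hρ1 hθ0 hθ1 hη hk,
      NoisyGT.errorTendsToOne_of_le hρ0 hρ1 hθ0 hθ1 hη hk⟩, ?_⟩
  obtain ⟨θ₀, hθ₀, hθ₀1, hach⟩ := NoisyGT.exists_achConst_eq hρ0 hρ1
  refine ⟨θ₀, hθ₀, hθ₀1, fun θ hθ0 hθ => ⟨hach θ hθ0 hθ, fun k hk η hη n => ⟨fun hn => ?_,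
    NoisyGT.errorTendsToOne_of_le hρ0 hρ1 hθ0 (hθ.trans hθ₀1) hη hk⟩⟩⟩
  refine NoisyGT.errorVanishes_of_achConst_le hρ0 hρ1 hθ0 (hθ.trans hθ₀1) hη hk ?_
  filter_upwards [hn] with p hp
  rw [hach θ hθ0 hθ, one_div_mul_eq_div]
  exact hp
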